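/- Let $(\Omega,\mathcal F,P)$ be a probability space with a filtration $(\mathcal F_t)_{t\ge 0}$, let $B$ be a standard Brownian motion with respect to $(\mathcal F_t)$, and let $\omega,\beta,\gamma,\alpha\in\mathbb R$ with $\beta\neq 0$. Let the log price $X$ follow the GARCH-Itô-OI model with drift $\mu=0$: there are a progressively measurable volatility process $\sigma$, whose square $\sigma^2$ has almost surely continuous paths, and $\mathcal F_n$-measurable real random variables $O_n$ ($n=0,1,2,\dots$, the option-implied variances) such that, almost surely for all $t\ge 0$, $$dX_t=\sigma_t\,dB_t,\qquad \sigma_t^2=\sigma_{[t]}^2+(t-[t])\bigl\{\omega+(\gamma-1)\sigma_{[t]}^2+\alpha O_{[t]}\bigr\}+\beta\Bigl(\int_{[t]}^t\sigma_s\,dB_s\Bigr)^2,$$ where $[t]$ is the integer part of $t$. For $n\ge 1$ let $Z_n=X_n-X_{n-1}$ be the daily log return and, when $Z_n$ is square integrable, let $h_n=\operatorname{Var}(Z_n\mid\mathcal F_{n-1})$ be the daily conditional variance. (a) For every $n\ge 2$ such that $Z_{n-1}$ and $Z_n$ are square integrable, almost surely $$h_n=\omega^g+\gamma h_{n-1}+\beta^g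 Z_{n-1}^2+\eta^g O_{n-1}+\xi^g O_{n-2},$$ where $$\omega^g=\beta^{-1}(e^\beta-1)\,\omega,\qquad \beta^g=\beta^{-1}(\gamma-1)(e^\beta-1-\beta)+e^\beta-1,$$ $$\eta^g=\beta^{-2}(e^\beta-1-\beta)\,\alpha,\qquad \xi^g=\bigl[\beta^{-1}(e^\beta-1)-\beta^{-2}(e^\beta-1-\beta)\bigr]\alpha.$$ (b) If $\sigma_0^2$ and all $O_n$ are integrable, then $Z_n$ is square integrable for every $n\ge 1$; hence the recursion in (a) holds for all $n\ge 2$. -/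

import Mathlib

open MeasureTheory ProbabilityTheory Filter Topology
open scoped NNReal ENNReal

namespace GarchIto

/-- `B` is a standard Brownian motion with respect to the filtration `F`: it is a Brownian motion
under `P`, it is adapted to `F`, and its increments after time `s` are independent of `F s`. -/
structure IsBrownianMotionWrt {Ω : Type*} {mΩ : MeasurableSpace Ω} (P : Measure Ω)
    (F : Filtration ℝ≥0 mΩ) (B : ℝ≥0 → Ω → ℝ) : Prop where
  isBrownian : IsBrownianReal B P
  adapted : StronglyAdapted F B
  indep_increment : ∀ s t : ℝ≥0, s ≤ t →
    Indep (MeasurableSpace.comap (B t - B s) inferInstance) (F s) P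

/-- A simple predictable process `∑_{i < len} coef i • 1_{(time i, time (i+1)]}` with bounded
coefficients, the `i`-th one measurable with respect to `F (time i)`. -/
structure SimpleProcess {Ω : Type*} {mΩ : MeasurableSpace Ω} (F : Filtration ℝ≥0 mΩ) where
  len : ℕ
  time : ℕ → ℝ≥0
  time_mono : Monotone time
  coef : ℕ → Ω → ℝ
  coef_measurable : ∀ i, StronglyMeasurable[F (time i)] (coef i)
  coef_bounded : ∀ i, ∃ C : ℝ, ∀ ω, |coef i ω| ≤ C

namespace SimpleProcess

/-- The value of a simple process at time `s`. -/
noncomputable def value {Ω : Type*} {mΩ : MeasurableSpace Ω} {F : Filtration ℝ≥0 mΩ}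
    (S : SimpleProcess F) (s : ℝ≥0) (ω : Ω) : ℝ :=
  ∑ i ∈ Finset.range S.len,
    (Set.Ioc (S.time i) (S.time (i + 1))).indicator (fun _ => S.coef i ω) s

/-- The elementary stochastic integral `∫_0^t S dB` of a simple process. -/
noncomputable def integral {Ω : Type*} {mΩ : MeasurableSpace Ω} {F : Filtration ℝ≥0 mΩ}
    (S : SimpleProcess F) (B : ℝ≥0 → Ω → ℝ) (t : ℝ≥0) (ω : Ω) : ℝ :=
  ∑ i ∈ Finset.range S.len,
    S.coef i ω * (B (min (S.time (i + 1)) t) ω - B (min (S.time i) t) ω)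

end SimpleProcess

/-- The (possibly infinite) quantity `∫_0^t (H_s - G_s)² ds` along a path. -/
noncomputable def sqDist {Ω : Type*} (H G : ℝ≥0 → Ω → ℝ) (t : ℝ≥0) (ω : Ω) : ℝ≥0∞ :=
  ∫⁻ s in Set.Icc (0 : ℝ) t, ENNReal.ofReal ((H s.toNNReal ω - G s.toNNReal ω) ^ 2)

/-- `I` is the Itô integral process `I t = ∫_0^t H dB`: the integrand `H` is progressively
measurable with `∫_0^t H² ds < ∞` almost surely, `I` has almost surely continuous paths, and there
are simple processes `S k` such that, for every `t`, `∫_0^t (S k - H)² ds → 0` and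
`∫_0^t S k dB → I t` in probability. (Such an `I` is unique up to indistinguishability.) -/
structure IsItoIntegral {Ω : Type*} {mΩ : MeasurableSpace Ω} (P : Measure Ω)
    (F : Filtration ℝ≥0 mΩ) (B H I : ℝ≥0 → Ω → ℝ) : Prop where
  progressive : IsStronglyProgressive F H
  sq_integrable : ∀ᵐ ω ∂P, ∀ t : ℝ≥0, sqDist H 0 t ω < ∞
  continuous_paths : ∀ᵐ ω ∂P, Continuous (fun t => I t ω)
  approx : ∃ S : ℕ → SimpleProcess F, ∀ t : ℝ≥0,
    (∀ ε : ℝ≥0∞, 0 < ε → Tendsto (fun k => P {ω | ε ≤ sqDist (S k).value H t ω}) atTop (𝓝 0)) ∧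
    TendstoInMeasure P (fun k => (S k).integral B t) atTop (I t)

/-- The parameter vector `(ω, β, γ, α)` of the model. -/
structure Params where
  ω : ℝ
  β : ℝ
  γ : ℝ
  α : ℝ

namespace Params

/-- `ω^g = β⁻¹ (e^β - 1) ω`. -/
noncomputable def ωg (θ : Params) : ℝ := θ.β⁻¹ * (Real.exp θ.β - 1) * θ.ω

/-- `β^g = β⁻¹ (γ - 1) (e^β - 1 - β) + e^β - 1`. -/
noncomputable def βg (θ : Params) : ℝ :=
  θ.β⁻¹ * (θ.γ - 1) * (Real.exp θ.β - 1 - θ.β) + Real.exp θ.β - 1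

/-- `η^g = β⁻² (e^β - 1 - β) α`. -/
noncomputable def ηg (θ : Params) : ℝ := (θ.β ^ 2)⁻¹ * (Real.exp θ.β - 1 - θ.β) * θ.α

/-- `ξ^g = [β⁻¹ (e^β - 1) - β⁻² (e^β - 1 - β)] α`. -/
noncomputable def ξg (θ : Params) : ℝ :=
  (θ.β⁻¹ * (Real.exp θ.β - 1) - (θ.β ^ 2)⁻¹ * (Real.exp θ.β - 1 - θ.β)) * θ.α

end Params

/-- The log price `X` follows the GARCH-Itô-OI model with parameters `θ`, drift `μ`, driving
Brownian motion `B`, instantaneous volatility `σ` (so that `σ t ω ^ 2` is the instantaneous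
variance, a process with continuous paths) and option-implied variances `O n`, `n = 0, 1, 2, …`:
`dX_t = μ dt + σ_t dB_t` and
`σ_t² = σ_[t]² + (t - [t]) (ω + (γ - 1) σ_[t]² + α O_[t]) + β (∫_[t]^t σ_s dB_s)²`. -/
structure IsGarchItoOI {Ω : Type*} {mΩ : MeasurableSpace Ω} (P : Measure Ω)
    (F : Filtration ℝ≥0 mΩ) (θ : Params) (μ : ℝ) (B σ : ℝ≥0 → Ω → ℝ) (O : ℕ → Ω → ℝ)
    (X : ℝ≥0 → Ω → ℝ) : Prop where
  brownian : IsBrownianMotionWrt P F B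
  option_measurable : ∀ n : ℕ, StronglyMeasurable[F n] (O n)
  continuous_variance : ∀ᵐ ω ∂P, Continuous (fun t => σ t ω ^ 2)
  /-- `I t` is `∫_0^t σ dB`, hence `I t - I [t]` is `∫_[t]^t σ dB`. -/
  dynamics : ∃ I : ℝ≥0 → Ω → ℝ, IsItoIntegral P F B σ I ∧
    (∀ᵐ ω ∂P, ∀ t : ℝ≥0, X t ω = X 0 ω + μ * t + I t ω) ∧
    (∀ᵐ ω ∂P, ∀ t : ℝ≥0,
      σ t ω ^ 2 = σ (⌊t⌋₊ : ℝ≥0) ω ^ 2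
        + ((t : ℝ) - ⌊t⌋₊) *
            (θ.ω + (θ.γ - 1) * σ (⌊t⌋₊ : ℝ≥0) ω ^ 2 + θ.α * O ⌊t⌋₊ ω)
        + θ.β * (I t ω - I (⌊t⌋₊ : ℝ≥0) ω) ^ 2)

/-- The daily log return `Z_n = X_n - X_{n-1}`, for `n ≥ 1`. -/
def dailyReturn {Ω : Type*} (X : ℝ≥0 → Ω → ℝ) (n : ℕ) (ω : Ω) : ℝ :=
  X (n : ℝ≥0) ω - X ((n - 1 : ℕ) : ℝ≥0) ω

/-- The daily conditional variance `h_n = Var(Z_n | F_{n-1})`, for `n ≥ 1`. -/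
noncomputable def dailyCondVar {Ω : Type*} {mΩ : MeasurableSpace Ω} (P : Measure Ω)
    (F : Filtration ℝ≥0 mΩ) (X : ℝ≥0 → Ω → ℝ) (n : ℕ) : Ω → ℝ :=
  Var[dailyReturn X n; P | F ((n - 1 : ℕ) : ℝ≥0)]

end GarchIto

/-!
The recursion comes from computing the conditional second moment of one daily return. On the day
`[s, s + 1]` let `M_t = ∫_s^t σ dB`, and write the squared volatility as
`σ_t² = v + (t - s) a + β M_t²` with `v = σ_s²` and `a = ω + (γ - 1) v + α O_s` known at time `s`.
By the Itô isometry the conditional second moment `f t` of `M_t` given the past of `s` solves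
`f' = v + (t - s) a + β f`, `f s = 0`, so that
`f (s + 1) = β⁻¹ (e^β - 1) v + β⁻² (e^β - 1 - β) a` (`integral_eq_of_volterra`). By continuity of
the variance, the next day starts with `v + a + β M_{s+1}²`, and eliminating `v` between two
consecutive days gives (a). If `v` and `a` are integrable then so is `M_{s+1}²`, and (b) follows
by induction.

The point that needs care is that `M` is a priori only a local martingale; square integrability of
`M_{s+1}` alone gives neither the martingale property nor the isometry. Both are obtained on the
events of the past on which `v` and `a` are bounded, and these events exhaust the probability space
(`IsVarianceDay.condVar_increment`, `IsVarianceDay.memLp_increment`). On such an event `A` a fourth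
moment argument works. Let `Q_t = ∫_s^t σ²`.

* For elementary integrals `N` with quadratic variation `q`, the heat polynomial
  `N⁴ - 6 N² q + 3 q²` has mean zero, whence `E[N⁴] ≤ 30 E[q²]`. A simple process can be switched
  off before its quadratic variation exceeds `R`, without leaving the class of simple processes
  (`SimpleProcess.cutoff`). Fatou's lemma then gives
  `E[1_A 1{Q_t < R} M_t⁴] ≤ 30 E[1_A min(Q_t, R)²]`
  (`StoppedApprox.lintegral_indicator_pow_four_le`).
* Inserted in the formula for `σ_t²`, this is a Grönwall inequality for
  `t ↦ E[1_A 1{Q_t < R} σ_t⁴]`, with constants that do not depend on `R`. Hence `E[1_A Q_t²] < ∞`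
  (`IsVarianceDay.lintegral_quadVar_sq_ne_top`).
* With this bound the stopped elementary integrals are uniformly integrable, together with their
  squares, so that the martingale property and the isometry pass to the limit
  (`StoppedApprox.isometry`).
-/

namespace GarchIto

/-! ### Random variables with moments of all orders -/

section Moments

variable {Ω : Type*} {mΩ : MeasurableSpace Ω} {P : Measure Ω}

/-- `f` has finite absolute moments of every order. -/
def HasAllMoments (f : Ω → ℝ) (P : Measure Ω) : Prop := ∀ p : ℝ≥0∞, p ≠ ∞ → MemLp f p P

namespace HasAllMoments

variable {f g : Ω → ℝ}

lemma integrable (hf : HasAllMoments f P) : Integrable f P :=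
  memLp_one_iff_integrable.1 (hf 1 ENNReal.one_ne_top)

lemma add (hf : HasAllMoments f P) (hg : HasAllMoments g P) :
    HasAllMoments (fun ω => f ω + g ω) P :=
  fun p hp => (hf p hp).add (hg p hp)

lemma mul (hf : HasAllMoments f P) (hg : HasAllMoments g P) :
    HasAllMoments (fun ω => f ω * g ω) P := by
  intro p hp
  have h2 : 2 * p ≠ ∞ := ENNReal.mul_ne_top (by norm_num) hp
  have : ENNReal.HolderTriple (2 * p) (2 * p) p := ⟨by
    rw [← two_mul, ENNReal.mul_inv (by simp) (by simp), ← mul_assoc,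
      ENNReal.mul_inv_cancel (by simp) (by simp), one_mul]⟩
  exact (hg _ h2).mul' (hf _ h2)

lemma of_bounded [IsFiniteMeasure P] (hf : AEStronglyMeasurable f P) {C : ℝ}
    (hC : ∀ ω, |f ω| ≤ C) : HasAllMoments f P :=
  fun _ _ => MemLp.of_bound hf C (ae_of_all _ hC)

lemma pow [IsFiniteMeasure P] (hf : HasAllMoments f P) (k : ℕ) :
    HasAllMoments (fun ω => f ω ^ k) P := by
  induction k with
  | zero => simpa using of_bounded (P := P) (f := fun _ => (1 : ℝ)) (by fun_prop) (C := 1) (by simp)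
  | succ k ih => simpa only [pow_succ] using ih.mul hf

lemma const_mul (hf : HasAllMoments f P) (c : ℝ) : HasAllMoments (fun ω => c * f ω) P :=
  fun p hp => (hf p hp).const_mul c

lemma sum {n : ℕ} {f : ℕ → Ω → ℝ} (hf : ∀ i, HasAllMoments (f i) P) :
    HasAllMoments (fun ω => ∑ i ∈ Finset.range n, f i ω) P :=
  fun p hp => memLp_finsetSum _ fun i _ => hf i p hp

end HasAllMoments

/-- The moments of order at most four of a centered Gaussian variable, read off from the
derivatives at `0` of its moment generating function `exp (v t² / 2)`. -/
lemma integral_pow_gaussianReal (v : ℝ≥0) :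
    (∫ x, x ∂gaussianReal 0 v = 0) ∧ (∫ x, x ^ 2 ∂gaussianReal 0 v = v) ∧
      (∫ x, x ^ 3 ∂gaussianReal 0 v = 0) ∧ (∫ x, x ^ 4 ∂gaussianReal 0 v = 3 * (v : ℝ) ^ 2) := by
  have key : ∀ n, iteratedDeriv n (mgf id (gaussianReal 0 v)) 0 = ∫ x, x ^ n ∂gaussianReal 0 v := by
    intro n
    rw [iteratedDeriv_mgf_zero]
    · rfl
    · simp [integrableExpSet, integrable_exp_mul_gaussianReal]
  have hm : mgf id (gaussianReal 0 v) = fun t => Real.exp (v * t ^ 2 / 2) := by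
    rw [mgf_id_gaussianReal]; simp
  have d : ∀ p q : ℝ → ℝ, (∀ t, HasDerivAt p (q t) t) →
      deriv (fun t => p t * Real.exp (v * t ^ 2 / 2)) =
        fun t => (q t + p t * (v * t)) * Real.exp (v * t ^ 2 / 2) := by
    intro p q h
    funext t
    have h2 : HasDerivAt (fun t : ℝ => (v : ℝ) * t ^ 2 / 2) (v * t) t := by
      have := (((hasDerivAt_id t).pow 2).const_mul (v : ℝ)).div_const 2
      simp only [id] at this
      convert! this using 1
      simp; ring
    have h3 : HasDerivAt (fun t => p t * Real.exp (v * t ^ 2 / 2))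
        (q t * Real.exp (v * t ^ 2 / 2) + p t * (Real.exp (v * t ^ 2 / 2) * (v * t))) t :=
      (h t).mul h2.exp
    rw [h3.deriv]
    ring
  have d1 : deriv (fun t : ℝ => Real.exp (v * t ^ 2 / 2)) =
      fun t => (v * t) * Real.exp (v * t ^ 2 / 2) := by
    simpa using d (fun _ => 1) (fun _ => 0) (fun t => hasDerivAt_const t 1)
  have d2 := d (fun t => v * t) (fun _ => v)
    (fun t => by simpa using (hasDerivAt_id t).const_mul (v : ℝ))
  have d3 := d (fun t => v + v * t * (v * t)) (fun t => 2 * (v : ℝ) ^ 2 * t) (fun t => by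
    have := (((hasDerivAt_id t).pow 2).const_mul ((v : ℝ) ^ 2)).const_add (v : ℝ)
    convert! this using 1
    · funext x; simp; ring
    · simp; ring)
  have d4 := d (fun t => 2 * (v : ℝ) ^ 2 * t + (v + v * t * (v * t)) * (v * t))
    (fun t => 3 * (v : ℝ) ^ 2 + 3 * (v : ℝ) ^ 3 * t ^ 2) (fun t => by
    have := ((hasDerivAt_id t).const_mul (3 * (v : ℝ) ^ 2)).add
      (((hasDerivAt_id t).pow 3).const_mul ((v : ℝ) ^ 3))
    convert! this using 1
    · funext x; simp; ring
    · simp; ring)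
  refine ⟨?_, ?_, ?_, ?_⟩
  · simp
  · rw [← key, hm]; simp only [iteratedDeriv_succ, iteratedDeriv_zero, d1, d2]; simp
  · rw [← key, hm]; simp only [iteratedDeriv_succ, iteratedDeriv_zero, d1, d2, d3]; simp
  · rw [← key, hm]; simp only [iteratedDeriv_succ, iteratedDeriv_zero, d1, d2, d3, d4]; simp

end Moments

/-! ### Moments of Brownian increments -/

namespace IsBrownianMotionWrt

variable {Ω : Type*} {mΩ : MeasurableSpace Ω} {P : Measure Ω}
  {F : Filtration ℝ≥0 mΩ} {B : ℝ≥0 → Ω → ℝ}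

lemma hasLaw_increment (hB : IsBrownianMotionWrt P F B) {s t : ℝ≥0} (hst : s ≤ t) :
    HasLaw (fun ω => B t ω - B s ω) (gaussianReal 0 (t - s)) P := by
  have h := hB.isBrownian.toIsPreBrownianReal.hasLaw_sub t s
  have e : nndist t.1 s.1 = t - s := by
    ext
    rw [coe_nndist, Real.dist_eq, NNReal.coe_sub hst]
    exact abs_of_nonneg (sub_nonneg.2 (NNReal.coe_le_coe.2 hst))
  rw [e] at h
  exact h

lemma hasAllMoments_increment (hB : IsBrownianMotionWrt P F B) {s t : ℝ≥0} (hst : s ≤ t) :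
    HasAllMoments (fun ω => B t ω - B s ω) P :=
  fun _ hp => (hB.hasLaw_increment hst).hasGaussianLaw.memLp hp

/-- A factor known at time `s` splits off from the moments of an increment after time `s`. -/
lemma integral_mul_pow_increment (hB : IsBrownianMotionWrt P F B) {s t : ℝ≥0} (hst : s ≤ t)
    {Y : Ω → ℝ} (hY : StronglyMeasurable[F s] Y) (k : ℕ) :
    ∫ ω, Y ω * (B t ω - B s ω) ^ k ∂P =
      (∫ ω, Y ω ∂P) * ∫ x, x ^ k ∂gaussianReal 0 (t - s) := by
  have hind : IndepFun Y (B t - B s) P := by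
    rw [IndepFun_iff_Indep]
    exact indep_of_indep_of_le_left (hB.indep_increment s t hst).symm hY.measurable.comap_le
  have hd : StronglyMeasurable (B t - B s) :=
    ((hB.adapted t).mono (F.le t)).sub ((hB.adapted s).mono (F.le s))
  have h2 : IndepFun Y ((fun x : ℝ => x ^ k) ∘ (B t - B s)) P :=
    hind.comp measurable_id (by fun_prop)
  have := h2.integral_fun_mul_eq_mul_integral (hY.mono (F.le s)).aestronglyMeasurable
    (hd.measurable.pow_const k).aestronglyMeasurable
  simp only [Function.comp_apply, Pi.sub_apply] at this
  rw [this, ← (hB.hasLaw_increment hst).integral_comp (f := fun x : ℝ => x ^ k) (by fun_prop)]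
  rfl

/-- The expectation of a polynomial of degree four in an increment after time `s`, with coefficients
known at time `s`. -/
lemma integral_quartic_increment [IsFiniteMeasure P] (hB : IsBrownianMotionWrt P F B) {s t : ℝ≥0}
    (hst : s ≤ t) {Y₀ Y₁ Y₂ Y₃ Y₄ : Ω → ℝ} (h₀ : HasAllMoments Y₀ P)
    (m₁ : StronglyMeasurable[F s] Y₁) (h₁ : HasAllMoments Y₁ P)
    (m₂ : StronglyMeasurable[F s] Y₂) (h₂ : HasAllMoments Y₂ P)
    (m₃ : StronglyMeasurable[F s] Y₃) (h₃ : HasAllMoments Y₃ P)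
    (m₄ : StronglyMeasurable[F s] Y₄) (h₄ : HasAllMoments Y₄ P) :
    ∫ ω, (Y₀ ω + Y₁ ω * (B t ω - B s ω) ^ 1 + Y₂ ω * (B t ω - B s ω) ^ 2
        + Y₃ ω * (B t ω - B s ω) ^ 3 + Y₄ ω * (B t ω - B s ω) ^ 4) ∂P =
      ∫ ω, (Y₀ ω + Y₂ ω * ((t : ℝ) - s) + Y₄ ω * (3 * ((t : ℝ) - s) ^ 2)) ∂P := by
  have hd := hB.hasAllMoments_increment hst
  have i₁ := (h₁.mul (hd.pow 1)).integrable
  have i₂ := (h₂.mul (hd.pow 2)).integrable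
  have i₃ := (h₃.mul (hd.pow 3)).integrable
  have i₄ := (h₄.mul (hd.pow 4)).integrable
  have i₀ := h₀.integrable
  have j₂ := h₂.integrable.mul_const ((t : ℝ) - s)
  have j₄ := h₄.integrable.mul_const (3 * ((t : ℝ) - s) ^ 2)
  have k₁ : Integrable (fun ω => Y₀ ω + Y₁ ω * (B t ω - B s ω) ^ 1) P := i₀.add i₁
  have k₂ : Integrable (fun ω => Y₀ ω + Y₁ ω * (B t ω - B s ω) ^ 1
    + Y₂ ω * (B t ω - B s ω) ^ 2) P := k₁.add i₂
  have k₃ : Integrable (fun ω => Y₀ ω + Y₁ ω * (B t ω - B s ω) ^ 1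
    + Y₂ ω * (B t ω - B s ω) ^ 2 + Y₃ ω * (B t ω - B s ω) ^ 3) P := k₂.add i₃
  have l₂ : Integrable (fun ω => Y₀ ω + Y₂ ω * ((t : ℝ) - s)) P := i₀.add j₂
  rw [integral_add k₃ i₄, integral_add k₂ i₃, integral_add k₁ i₂, integral_add i₀ i₁,
    integral_add l₂ j₄, integral_add i₀ j₂, integral_mul_const, integral_mul_const,
    hB.integral_mul_pow_increment hst m₁, hB.integral_mul_pow_increment hst m₂,
    hB.integral_mul_pow_increment hst m₃, hB.integral_mul_pow_increment hst m₄]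
  obtain ⟨e1, e2, e3, e4⟩ := integral_pow_gaussianReal (t - s)
  simp only [pow_one]
  rw [e1, e2, e3, e4, NNReal.coe_sub hst]
  ring

end IsBrownianMotionWrt

/-! ### Moments of elementary stochastic integrals -/

namespace SimpleProcess

variable {Ω : Type*} {mΩ : MeasurableSpace Ω} {P : Measure Ω}
  {F : Filtration ℝ≥0 mΩ} {B : ℝ≥0 → Ω → ℝ}

/-- The elementary stochastic integral over the first `n` blocks of `S`. -/
def sumUpTo (S : SimpleProcess F) (B : ℝ≥0 → Ω → ℝ) (n : ℕ) (ω : Ω) : ℝ :=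
  ∑ i ∈ Finset.range n, S.coef i ω * (B (S.time (i + 1)) ω - B (S.time i) ω)

/-- The integral of `S ^ 2` over the first `n` blocks of `S`, that is, the quadratic variation of
`S.sumUpTo B`. -/
def varUpTo (S : SimpleProcess F) (n : ℕ) (ω : Ω) : ℝ :=
  ∑ i ∈ Finset.range n, S.coef i ω ^ 2 * ((S.time (i + 1) : ℝ) - S.time i)

variable (S : SimpleProcess F)

lemma sumUpTo_succ (n : ℕ) (ω : Ω) : S.sumUpTo B (n + 1) ω =
    S.sumUpTo B n ω + S.coef n ω * (B (S.time (n + 1)) ω - B (S.time n) ω) :=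
  Finset.sum_range_succ _ _

lemma varUpTo_succ (n : ℕ) (ω : Ω) : S.varUpTo (n + 1) ω =
    S.varUpTo n ω + S.coef n ω ^ 2 * ((S.time (n + 1) : ℝ) - S.time n) :=
  Finset.sum_range_succ _ _

lemma time_sub_nonneg (i : ℕ) : 0 ≤ (S.time (i + 1) : ℝ) - S.time i :=
  sub_nonneg.2 (NNReal.coe_le_coe.2 (S.time_mono i.le_succ))

lemma varUpTo_mono (ω : Ω) : Monotone fun n => S.varUpTo n ω :=
  monotone_nat_of_le_succ fun n => by
    rw [varUpTo_succ]
    exact le_add_of_nonneg_right (mul_nonneg (sq_nonneg _) (S.time_sub_nonneg n))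

lemma varUpTo_nonneg (n : ℕ) (ω : Ω) : 0 ≤ S.varUpTo n ω :=
  Finset.sum_nonneg fun i _ => mul_nonneg (sq_nonneg _) (S.time_sub_nonneg i)

/-- The quadratic variation over the first `n + 1` blocks is known at the start of the last one. -/
lemma stronglyMeasurable_varUpTo_succ (n : ℕ) :
    StronglyMeasurable[F (S.time n)] (S.varUpTo (n + 1)) := by
  refine Finset.stronglyMeasurable_fun_sum _ fun i hi => ?_
  have hi' : i ≤ n := Nat.lt_succ_iff.1 (Finset.mem_range.1 hi)
  exact (((S.coef_measurable i).mono (F.mono (S.time_mono hi'))).pow 2).mul_const _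

lemma stronglyMeasurable_varUpTo (n : ℕ) : StronglyMeasurable[F (S.time n)] (S.varUpTo n) := by
  refine Finset.stronglyMeasurable_fun_sum _ fun i hi => ?_
  have hi' : i ≤ n := (Finset.mem_range.1 hi).le
  exact (((S.coef_measurable i).mono (F.mono (S.time_mono hi'))).pow 2).mul_const _

lemma stronglyMeasurable_sumUpTo (hB : StronglyAdapted F B) (n : ℕ) :
    StronglyMeasurable[F (S.time n)] (S.sumUpTo B n) := by
  refine Finset.stronglyMeasurable_fun_sum _ fun i hi => ?_
  have hi' : i + 1 ≤ n := Finset.mem_range.1 hi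
  exact ((S.coef_measurable i).mono (F.mono (S.time_mono (i.le_succ.trans hi')))).mul
    (((hB _).mono (F.mono (S.time_mono hi'))).sub
      ((hB _).mono (F.mono (S.time_mono (i.le_succ.trans hi')))))

lemma hasAllMoments_coef [IsFiniteMeasure P] (i : ℕ) : HasAllMoments (S.coef i) P := by
  obtain ⟨C, hC⟩ := S.coef_bounded i
  exact .of_bounded ((S.coef_measurable i).mono (F.le _)).aestronglyMeasurable hC

lemma hasAllMoments_sumUpTo [IsFiniteMeasure P] (hB : IsBrownianMotionWrt P F B) (n : ℕ) :
    HasAllMoments (S.sumUpTo B n) P :=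
  .sum fun i => (S.hasAllMoments_coef i).mul (hB.hasAllMoments_increment (S.time_mono i.le_succ))

lemma hasAllMoments_varUpTo [IsFiniteMeasure P] (n : ℕ) : HasAllMoments (S.varUpTo n) P :=
  .sum fun i => by
    simpa only [mul_comm] using ((S.hasAllMoments_coef i).pow 2).const_mul
      ((S.time (i + 1) : ℝ) - S.time i)

section

variable [IsFiniteMeasure P] {S} {W : Ω → ℝ}

lemma integral_mul_sumUpTo (hB : IsBrownianMotionWrt P F B)
    (mW : StronglyMeasurable[F (S.time 0)] W) (hW : HasAllMoments W P) (n : ℕ) :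
    ∫ ω, W ω * S.sumUpTo B n ω ∂P = 0 := by
  induction n with
  | zero => simp [sumUpTo]
  | succ n ih =>
    have mW' := mW.mono (F.mono (S.time_mono (Nat.zero_le n)))
    have z : StronglyMeasurable[F (S.time n)] fun _ : Ω => (0 : ℝ) := stronglyMeasurable_const
    have hz : HasAllMoments (fun _ : Ω => (0 : ℝ)) P := fun _ _ => MemLp.zero
    have := hB.integral_quartic_increment (S.time_mono n.le_succ)
      (hW.mul (S.hasAllMoments_sumUpTo hB n))
      (mW'.mul (S.coef_measurable n)) (hW.mul (S.hasAllMoments_coef n)) z hz z hz z hz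
    simp only [zero_mul, add_zero, ih] at this
    rw [← this]
    congr 1 with ω
    rw [sumUpTo_succ]
    simp only [Pi.mul_apply]
    ring

lemma integral_mul_sumUpTo_sq (hB : IsBrownianMotionWrt P F B)
    (mW : StronglyMeasurable[F (S.time 0)] W) (hW : HasAllMoments W P) (n : ℕ) :
    ∫ ω, W ω * (S.sumUpTo B n ω ^ 2 - S.varUpTo n ω) ∂P = 0 := by
  induction n with
  | zero => simp [sumUpTo, varUpTo]
  | succ n ih =>
    have mW' := mW.mono (F.mono (S.time_mono (Nat.zero_le n)))
    have z : StronglyMeasurable[F (S.time n)] fun _ : Ω => (0 : ℝ) := stronglyMeasurable_const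
    have hz : HasAllMoments (fun _ : Ω => (0 : ℝ)) P := fun _ _ => MemLp.zero
    have hN := S.hasAllMoments_sumUpTo hB n
    have mN := S.stronglyMeasurable_sumUpTo hB.adapted n
    have hc := S.hasAllMoments_coef (P := P) n
    have mc := S.coef_measurable n
    have hq := S.hasAllMoments_varUpTo (P := P) (n + 1)
    have := hB.integral_quartic_increment (S.time_mono n.le_succ)
      (hW.mul ((hN.pow 2).add (hq.const_mul (-1))))
      ((mW'.mul mc).mul (mN.const_mul 2)) ((hW.mul hc).mul (hN.const_mul 2))
      (mW'.mul (mc.pow 2)) (hW.mul (hc.pow 2)) z hz z hz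
    simp only [zero_mul, add_zero, Pi.mul_apply, Pi.pow_apply] at this
    rw [← ih]
    refine Eq.trans ?_ (this.trans ?_)
    · congr 1 with ω
      rw [sumUpTo_succ]
      ring
    · congr 1 with ω
      rw [varUpTo_succ]
      ring

/-- The fourth heat polynomial of an elementary stochastic integral and of its quadratic variation
is a martingale. -/
lemma integral_mul_sumUpTo_pow_four (hB : IsBrownianMotionWrt P F B)
    (mW : StronglyMeasurable[F (S.time 0)] W) (hW : HasAllMoments W P) (n : ℕ) :
    ∫ ω, W ω * (S.sumUpTo B n ω ^ 4 - 6 * S.sumUpTo B n ω ^ 2 * S.varUpTo n ω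
      + 3 * S.varUpTo n ω ^ 2) ∂P = 0 := by
  induction n with
  | zero => simp [sumUpTo, varUpTo]
  | succ n ih =>
    have mW' := mW.mono (F.mono (S.time_mono (Nat.zero_le n)))
    have hN := S.hasAllMoments_sumUpTo hB n
    have mN := S.stronglyMeasurable_sumUpTo hB.adapted n
    have hc := S.hasAllMoments_coef (P := P) n
    have mc := S.coef_measurable n
    have hq := S.hasAllMoments_varUpTo (P := P) (n + 1)
    have mq := S.stronglyMeasurable_varUpTo_succ n
    have := hB.integral_quartic_increment (S.time_mono n.le_succ)
      (hW.mul (((hN.pow 4).add (((hN.pow 2).mul hq).const_mul (-6))).add ((hq.pow 2).const_mul 3)))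
      ((mW'.mul mc).mul (((mN.pow 3).const_mul 4).add ((mN.mul mq).const_mul (-12))))
      ((hW.mul hc).mul (((hN.pow 3).const_mul 4).add ((hN.mul hq).const_mul (-12))))
      ((mW'.mul (mc.pow 2)).mul (((mN.pow 2).const_mul 6).add (mq.const_mul (-6))))
      ((hW.mul (hc.pow 2)).mul (((hN.pow 2).const_mul 6).add (hq.const_mul (-6))))
      ((mW'.mul (mc.pow 3)).mul (mN.const_mul 4)) ((hW.mul (hc.pow 3)).mul (hN.const_mul 4))
      (mW'.mul (mc.pow 4)) (hW.mul (hc.pow 4))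
    simp only [Pi.mul_apply, Pi.pow_apply, Pi.add_apply] at this
    rw [← ih]
    refine Eq.trans ?_ (this.trans ?_)
    · congr 1 with ω
      rw [sumUpTo_succ]
      ring
    · congr 1 with ω
      rw [varUpTo_succ]
      ring

end

lemma integral_indicator_one_mul {A : Set Ω} (hA : MeasurableSet A) (f : Ω → ℝ) :
    ∫ ω, A.indicator 1 ω * f ω ∂P = ∫ ω in A, f ω ∂P := by
  rw [← integral_indicator hA]
  congr 1 with ω
  by_cases h : ω ∈ A <;> simp [h]

section SetIntegral

variable [IsFiniteMeasure P] {S} {A : Set Ω}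

lemma hasAllMoments_indicator_one (hA : MeasurableSet A) :
    HasAllMoments (A.indicator (1 : Ω → ℝ)) P := by
  refine .of_bounded (C := 1) (measurable_one.indicator hA).aestronglyMeasurable fun ω => ?_
  by_cases h : ω ∈ A <;> simp [h]

lemma setIntegral_sumUpTo (hB : IsBrownianMotionWrt P F B) (hA : MeasurableSet[F (S.time 0)] A)
    (n : ℕ) : ∫ ω in A, S.sumUpTo B n ω ∂P = 0 := by
  rw [← integral_indicator_one_mul (F.le _ _ hA)]
  exact integral_mul_sumUpTo hB (stronglyMeasurable_one.indicator hA)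
    (hasAllMoments_indicator_one (F.le _ _ hA)) n

lemma setIntegral_sumUpTo_sq (hB : IsBrownianMotionWrt P F B)
    (hA : MeasurableSet[F (S.time 0)] A) (n : ℕ) :
    ∫ ω in A, S.sumUpTo B n ω ^ 2 ∂P = ∫ ω in A, S.varUpTo n ω ∂P := by
  have h := integral_mul_sumUpTo_sq hB (stronglyMeasurable_one.indicator hA)
    (hasAllMoments_indicator_one (F.le _ _ hA)) n
  rw [integral_indicator_one_mul (F.le _ _ hA),
    integral_sub ((S.hasAllMoments_sumUpTo hB n).pow 2).integrable.integrableOn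
      (S.hasAllMoments_varUpTo n).integrable.integrableOn] at h
  exact sub_eq_zero.1 h

lemma setIntegral_sumUpTo_pow_four_le (hB : IsBrownianMotionWrt P F B)
    (hA : MeasurableSet[F (S.time 0)] A) (n : ℕ) :
    ∫ ω in A, S.sumUpTo B n ω ^ 4 ∂P ≤ 30 * ∫ ω in A, S.varUpTo n ω ^ 2 ∂P := by
  have h := integral_mul_sumUpTo_pow_four hB (stronglyMeasurable_one.indicator hA)
    (hasAllMoments_indicator_one (F.le _ _ hA)) n
  rw [integral_indicator_one_mul (F.le _ _ hA)] at h
  have hN := S.hasAllMoments_sumUpTo hB n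
  have hq := S.hasAllMoments_varUpTo (P := P) n
  have i₄ := (hN.pow 4).integrable.integrableOn (s := A)
  have i₂ := (hq.pow 2).integrable.integrableOn (s := A)
  have i₃ : IntegrableOn (fun ω => S.sumUpTo B n ω ^ 4 - 6 * S.sumUpTo B n ω ^ 2 * S.varUpTo n ω
      + 3 * S.varUpTo n ω ^ 2) A P := by
    have := (((hN.pow 4).add (((hN.pow 2).mul hq).const_mul (-6))).add
      ((hq.pow 2).const_mul 3)).integrable.integrableOn (s := A)
    convert! this using 2
    ring
  -- `6 N² q ≤ N⁴ / 2 + 18 q²`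
  have : ∫ ω in A, (S.sumUpTo B n ω ^ 4 - 30 * S.varUpTo n ω ^ 2) ∂P ≤
      ∫ ω in A, 2 * (S.sumUpTo B n ω ^ 4 - 6 * S.sumUpTo B n ω ^ 2 * S.varUpTo n ω
      + 3 * S.varUpTo n ω ^ 2) ∂P := by
    refine integral_mono (i₄.sub (i₂.const_mul 30)) (i₃.const_mul 2) fun ω => ?_
    nlinarith [sq_nonneg (S.sumUpTo B n ω ^ 2 - 6 * S.varUpTo n ω)]
  rw [integral_const_mul, h, integral_sub i₄ (i₂.const_mul 30), integral_const_mul] at this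
  linarith

end SetIntegral

/-! ### Restricting and cutting off simple processes -/

/-- The restriction of `S` to the time interval `(s, t]`: all grid times are projected to
`[s, t]`. Blocks that start after `t` become empty, and their coefficients, which need not be known
at time `t`, are set to `0`. -/
noncomputable def restrict (s t : ℝ≥0) : SimpleProcess F where
  len := S.len
  time i := max s (min (S.time i) t)
  time_mono i j hij := max_le_max le_rfl (min_le_min (S.time_mono hij) le_rfl)
  coef i := if S.time i ≤ t then S.coef i else 0
  coef_measurable i := by
    split_ifs with h
    · refine (S.coef_measurable i).mono (F.mono ?_)
      rw [min_eq_left h]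
      exact le_max_right _ _
    · exact stronglyMeasurable_zero
  coef_bounded i := by
    split_ifs with h
    · exact S.coef_bounded i
    · exact ⟨0, by simp⟩

open Classical in
/-- The process `S`, switched off before the first block at whose end its quadratic variation
exceeds `R`. As the quadratic variation at the end of a block is known at its start, this is again
a simple process. -/
noncomputable def cutoff (R : ℝ) : SimpleProcess F where
  len := S.len
  time := S.time
  time_mono := S.time_mono
  coef i := {ω | S.varUpTo (i + 1) ω ≤ R}.indicator (S.coef i)
  coef_measurable i := (S.coef_measurable i).indicator
    ((S.stronglyMeasurable_varUpTo_succ i).measurable measurableSet_Iic)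
  coef_bounded i := by
    obtain ⟨C, hC⟩ := S.coef_bounded i
    refine ⟨C, fun ω => ?_⟩
    rw [Set.indicator_apply]
    split_ifs
    · exact hC ω
    · simpa using (abs_nonneg _).trans (hC ω)

lemma varUpTo_cutoff_le (R : ℝ) (n : ℕ) (ω : Ω) : (S.cutoff R).varUpTo n ω ≤ S.varUpTo n ω := by
  refine Finset.sum_le_sum fun i _ => mul_le_mul_of_nonneg_right ?_ (S.time_sub_nonneg i)
  simp only [cutoff, Set.indicator_apply]
  split_ifs
  · exact le_rfl
  · simpa using sq_nonneg _

lemma varUpTo_cutoff_le_level {R : ℝ} (hR : 0 ≤ R) (n : ℕ) (ω : Ω) :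
    (S.cutoff R).varUpTo n ω ≤ R := by
  induction n with
  | zero => simpa [varUpTo] using hR
  | succ n ih =>
    by_cases h : S.varUpTo (n + 1) ω ≤ R
    · exact (S.varUpTo_cutoff_le R (n + 1) ω).trans h
    · rw [varUpTo_succ]
      simpa [cutoff, h] using ih

lemma coef_cutoff {R : ℝ} {n i : ℕ} {ω : Ω} (h : S.varUpTo n ω ≤ R) (hi : i < n) :
    (S.cutoff R).coef i ω = S.coef i ω :=
  Set.indicator_of_mem (show ω ∈ {ω | S.varUpTo (i + 1) ω ≤ R} from
    (S.varUpTo_mono ω hi).trans h) _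

lemma varUpTo_cutoff {R : ℝ} {n : ℕ} {ω : Ω} (h : S.varUpTo n ω ≤ R) :
    (S.cutoff R).varUpTo n ω = S.varUpTo n ω :=
  Finset.sum_congr rfl fun i hi => by rw [S.coef_cutoff h (Finset.mem_range.1 hi)]; rfl

lemma sumUpTo_cutoff {R : ℝ} {n : ℕ} {ω : Ω} (h : S.varUpTo n ω ≤ R) :
    (S.cutoff R).sumUpTo B n ω = S.sumUpTo B n ω :=
  Finset.sum_congr rfl fun i hi => by rw [S.coef_cutoff h (Finset.mem_range.1 hi)]; rfl

lemma sumUpTo_restrict {s t : ℝ≥0} (hst : s ≤ t) (ω : Ω) :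
    (S.restrict s t).sumUpTo B S.len ω = S.integral B t ω - S.integral B s ω := by
  have key : ∀ a, B (min a t) ω - B (min a s) ω = B (max s (min a t)) ω - B s ω := by
    intro a
    rcases le_total a s with h | h
    · rw [min_eq_left h, min_eq_left (h.trans hst), max_eq_left h, sub_self, sub_self]
    · rw [min_eq_right h, max_eq_right (le_min h hst)]
  unfold integral
  rw [← Finset.sum_sub_distrib]
  refine Finset.sum_congr rfl fun i _ => ?_
  have h1 := key (S.time i)
  have h2 := key (S.time (i + 1))
  simp only [restrict]
  split_ifs with h
  · linear_combination S.coef i ω * (h1 - h2)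
  · have h' := (not_le.1 h).le
    have h'' := h'.trans (S.time_mono i.le_succ)
    simp [min_eq_right h', min_eq_right h'', min_eq_right (hst.trans h'),
      min_eq_right (hst.trans h'')]

/-- At most one block of a simple process is active at each time. -/
lemma value_sq (u : ℝ≥0) (ω : Ω) : S.value u ω ^ 2 = ∑ i ∈ Finset.range S.len,
    (Set.Ioc (S.time i) (S.time (i + 1))).indicator (fun _ => S.coef i ω ^ 2) u := by
  unfold value
  by_cases h : ∃ i ∈ Finset.range S.len, u ∈ Set.Ioc (S.time i) (S.time (i + 1))
  · obtain ⟨i, hi, hu⟩ := h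
    have hj : ∀ j, j ≠ i → u ∉ Set.Ioc (S.time j) (S.time (j + 1)) := by
      intro j hji hj
      rcases lt_or_gt_of_ne hji with h | h
      · exact absurd (hj.2.trans (S.time_mono h)) (not_le.2 hu.1)
      · exact absurd (hu.2.trans (S.time_mono h)) (not_le.2 hj.1)
    rw [Finset.sum_eq_single_of_mem i hi fun j _ hji => Set.indicator_of_notMem (hj j hji) _,
      Finset.sum_eq_single_of_mem i hi fun j _ hji => Set.indicator_of_notMem (hj j hji) _,
      Set.indicator_of_mem hu, Set.indicator_of_mem hu]
  · push Not at h
    rw [Finset.sum_eq_zero fun i hi => Set.indicator_of_notMem (h i hi) _,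
      Finset.sum_eq_zero fun i hi => Set.indicator_of_notMem (h i hi) _]
    simp

lemma measurable_value (ω : Ω) : Measurable fun u : ℝ => S.value u.toNNReal ω := by
  unfold value
  refine Finset.measurable_sum _ fun i _ => ?_
  exact (measurable_const.indicator measurableSet_Ioc).comp measurable_real_toNNReal

lemma lintegral_value_sq {s t : ℝ≥0} (hst : s ≤ t) (ω : Ω) :
    ∫⁻ u in Set.Ioc (s : ℝ) t, ENNReal.ofReal (S.value u.toNNReal ω ^ 2) =
      ENNReal.ofReal ((S.restrict s t).varUpTo S.len ω) := by
  have h1 : ∀ u : ℝ, u ∈ Set.Ioc (s : ℝ) t → ENNReal.ofReal (S.value u.toNNReal ω ^ 2) =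
      ∑ i ∈ Finset.range S.len, (Set.Ioc (S.time i : ℝ) (S.time (i + 1))).indicator
        (fun _ => ENNReal.ofReal (S.coef i ω ^ 2)) u := by
    intro u hu
    rw [value_sq, ENNReal.ofReal_sum_of_nonneg
      fun i _ => Set.indicator_nonneg (fun _ _ => sq_nonneg _) _]
    refine Finset.sum_congr rfl fun i _ => ?_
    have hu0 : 0 ≤ u := s.2.trans hu.1.le
    have : u.toNNReal ∈ Set.Ioc (S.time i) (S.time (i + 1)) ↔
        u ∈ Set.Ioc (S.time i : ℝ) (S.time (i + 1)) := by
      simp only [Set.mem_Ioc, ← NNReal.coe_lt_coe, ← NNReal.coe_le_coe, Real.coe_toNNReal u hu0]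
    by_cases h : u ∈ Set.Ioc (S.time i : ℝ) (S.time (i + 1))
    · rw [Set.indicator_of_mem h, Set.indicator_of_mem (this.2 h)]
    · rw [Set.indicator_of_notMem h, Set.indicator_of_notMem (fun h' => h (this.1 h')),
        ENNReal.ofReal_zero]
  rw [setLIntegral_congr_fun measurableSet_Ioc h1,
    lintegral_finsetSum _ fun i _ => measurable_const.indicator measurableSet_Ioc, varUpTo,
    ENNReal.ofReal_sum_of_nonneg
      fun i _ => mul_nonneg (sq_nonneg _) ((S.restrict s t).time_sub_nonneg i)]
  refine Finset.sum_congr rfl fun i _ => ?_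
  rw [lintegral_indicator measurableSet_Ioc, setLIntegral_const,
    Measure.restrict_apply measurableSet_Ioc, Set.Ioc_inter_Ioc, Real.volume_Ioc,
    ENNReal.ofReal_mul (sq_nonneg _)]
  have hst' : (s : ℝ) ≤ t := NNReal.coe_le_coe.2 hst
  have hi : (S.time i : ℝ) ≤ S.time (i + 1) := NNReal.coe_le_coe.2 (S.time_mono i.le_succ)
  simp only [restrict, NNReal.coe_max, NNReal.coe_min]
  split_ifs with h
  · have ht : (S.time i : ℝ) ≤ t := NNReal.coe_le_coe.2 h
    congr 1
    rcases le_total (S.time (i + 1) : ℝ) s with h1 | h1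
    · rw [ENNReal.ofReal_of_nonpos (by grind), ENNReal.ofReal_of_nonpos (by grind)]
    · congr 1; grind
  · have h' : (t : ℝ) < S.time i := NNReal.coe_lt_coe.2 (not_le.1 h)
    have e : min (S.time (i + 1) : ℝ) t - max (S.time i : ℝ) s ≤ 0 := by grind
    rw [ENNReal.ofReal_of_nonpos e]
    simp

end SimpleProcess

/-! ### Passing to the limit in stochastic integrals -/

section Convergence

/-- A sequence that is bounded in `L²` and converges almost everywhere converges in `L¹`. -/
lemma tendsto_integral_of_sq_bounded {α : Type*} {mα : MeasurableSpace α} {μ : Measure α}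
    [IsFiniteMeasure μ] {f : ℕ → α → ℝ} {g : α → ℝ} {C : ℝ≥0∞} (hC : C ≠ ∞)
    (hf : ∀ k, AEStronglyMeasurable (f k) μ)
    (hbd : ∀ k, ∫⁻ x, ENNReal.ofReal (f k x ^ 2) ∂μ ≤ C)
    (hfg : ∀ᵐ x ∂μ, Tendsto (fun k => f k x) atTop (𝓝 (g x))) :
    Integrable g μ ∧ Tendsto (fun k => ∫ x, f k x ∂μ) atTop (𝓝 (∫ x, g x ∂μ)) := by
  have hnorm : ∀ k, eLpNorm (f k) 2 μ ≤ C ^ (2⁻¹ : ℝ) := by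
    intro k
    rw [eLpNorm_eq_lintegral_rpow_enorm_toReal two_ne_zero ENNReal.ofNat_ne_top]
    simp only [ENNReal.toReal_ofNat, one_div, ENNReal.rpow_ofNat]
    refine ENNReal.rpow_le_rpow (le_trans (le_of_eq ?_) (hbd k)) (by norm_num)
    refine lintegral_congr fun x => ?_
    rw [Real.enorm_eq_ofReal_abs, ← ENNReal.ofReal_pow (abs_nonneg _), sq_abs]
  have hC' : C ^ (2⁻¹ : ℝ) ≠ ∞ := ENNReal.rpow_ne_top_of_nonneg (by norm_num) hC
  have hg2 : eLpNorm g 2 μ ≤ C ^ (2⁻¹ : ℝ) :=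
    Lp.eLpNorm_le_of_ae_tendsto (Eventually.of_forall hnorm) hf hfg
  have hgm : AEStronglyMeasurable g μ := aestronglyMeasurable_of_tendsto_ae atTop hf hfg
  have hgL : MemLp g 2 μ := ⟨hgm, hg2.trans_lt hC'.lt_top⟩
  have hg1 : MemLp g 1 μ := hgL.mono_exponent one_le_two
  have hfi : ∀ k, Integrable (f k) μ := fun k => MemLp.integrable one_le_two
    (⟨hf k, (hnorm k).trans_lt hC'.lt_top⟩ : MemLp (f k) 2 μ)
  have hui : UnifIntegrable f 1 μ := by
    intro ε hε
    obtain ⟨c, hc⟩ : ∃ c : ℝ≥0, (c : ℝ≥0∞) = C ^ (2⁻¹ : ℝ) := ⟨_, ENNReal.coe_toNNReal hC'⟩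
    have hc1 : (0 : ℝ) < c + 1 := by positivity
    refine ⟨(ε / (c + 1)) ^ 2, by positivity, fun k s hs hμs => ?_⟩
    rw [eLpNorm_indicator_eq_eLpNorm_restrict hs]
    have h1 := eLpNorm_le_eLpNorm_mul_rpow_measure_univ (μ := μ.restrict s) (p := 1) (q := 2)
      one_le_two (hf k).restrict
    refine h1.trans ?_
    have h2 : eLpNorm (f k) 2 (μ.restrict s) ≤ c :=
      (eLpNorm_mono_measure _ Measure.restrict_le_self).trans ((hnorm k).trans hc.ge)
    have h3 : (μ.restrict s) Set.univ ^ (1 / (1 : ℝ≥0∞).toReal - 1 / (2 : ℝ≥0∞).toReal) ≤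
        ENNReal.ofReal (ε / (c + 1)) := by
      have e : (1 / (1 : ℝ≥0∞).toReal - 1 / (2 : ℝ≥0∞).toReal) = 1 / 2 := by norm_num
      rw [e, Measure.restrict_apply_univ]
      refine (ENNReal.rpow_le_rpow hμs (by norm_num)).trans (le_of_eq ?_)
      rw [ENNReal.ofReal_rpow_of_nonneg (by positivity) (by norm_num), ← Real.sqrt_eq_rpow,
        Real.sqrt_sq (by positivity)]
    refine (mul_le_mul' h2 h3).trans ?_
    rw [← ENNReal.ofReal_coe_nnreal, ← ENNReal.ofReal_mul c.coe_nonneg]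
    refine ENNReal.ofReal_le_ofReal ?_
    rw [mul_div_assoc', div_le_iff₀ hc1]
    nlinarith
  have hT := tendsto_Lp_finite_of_tendsto_ae le_rfl ENNReal.one_ne_top hf hg1 hui hfg
  exact ⟨memLp_one_iff_integrable.1 hg1,
    tendsto_integral_of_L1' g hgm (Eventually.of_forall hfi) hT⟩

/-- Convergence in `L²` implies convergence of the integrals of the squares. -/
lemma tendsto_lintegral_sq {α : Type*} {mα : MeasurableSpace α} {μ : Measure α}
    {f : ℕ → α → ℝ} {g : α → ℝ} (hf : ∀ k, AEStronglyMeasurable (f k) μ)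
    (hg : AEStronglyMeasurable g μ) (hfin : ∫⁻ x, ENNReal.ofReal (g x ^ 2) ∂μ ≠ ∞)
    (hfg : Tendsto (fun k => ∫⁻ x, ENNReal.ofReal ((f k x - g x) ^ 2) ∂μ) atTop (𝓝 0)) :
    Tendsto (fun k => ∫⁻ x, ENNReal.ofReal (f k x ^ 2) ∂μ) atTop
      (𝓝 (∫⁻ x, ENNReal.ofReal (g x ^ 2) ∂μ)) := by
  have key : ∀ h : α → ℝ, ∫⁻ x, ENNReal.ofReal (h x ^ 2) ∂μ = eLpNorm h 2 μ ^ 2 := by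
    intro h
    rw [eLpNorm_eq_lintegral_rpow_enorm_toReal two_ne_zero ENNReal.ofNat_ne_top]
    simp only [ENNReal.toReal_ofNat, one_div, ENNReal.rpow_ofNat]
    rw [← ENNReal.rpow_natCast, ← ENNReal.rpow_mul]
    simp only [Nat.cast_ofNat, isUnit_iff_ne_zero, ne_eq, OfNat.ofNat_ne_zero, not_false_eq_true,
      IsUnit.inv_mul_cancel, ENNReal.rpow_one]
    refine lintegral_congr fun x => ?_
    rw [Real.enorm_eq_ofReal_abs, ← ENNReal.ofReal_pow (abs_nonneg _), sq_abs]
  have hd : Tendsto (fun k => eLpNorm (f k - g) 2 μ) atTop (𝓝 0) := by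
    have h1 := hfg.ennrpow_const (2⁻¹ : ℝ)
    rw [ENNReal.zero_rpow_of_pos (by norm_num)] at h1
    refine h1.congr fun k => ?_
    have := key (f k - g)
    simp only [Pi.sub_apply] at this
    rw [this, ← ENNReal.rpow_natCast, ← ENNReal.rpow_mul]
    norm_num
  have hgt : eLpNorm g 2 μ ≠ ∞ := by
    intro h
    rw [key, h] at hfin
    simp at hfin
  simp only [key]
  refine ((ENNReal.continuous_pow 2).tendsto _).comp ?_
  refine tendsto_of_tendsto_of_tendsto_of_le_of_le
    (g := fun k => eLpNorm g 2 μ - eLpNorm (f k - g) 2 μ)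
    (h := fun k => eLpNorm (f k - g) 2 μ + eLpNorm g 2 μ) ?_ ?_ (fun k => ?_) (fun k => ?_)
  · simpa using ENNReal.Tendsto.sub tendsto_const_nhds hd (Or.inl hgt)
  · simpa using hd.add (tendsto_const_nhds (x := eLpNorm g 2 μ))
  · rw [tsub_le_iff_left]
    have := eLpNorm_add_le (p := 2) (hg.sub (hf k)) (hf k) one_le_two
    rw [sub_add_cancel, eLpNorm_sub_comm] at this
    exact this
  · have := eLpNorm_add_le (p := 2) ((hf k).sub hg) hg one_le_two
    rwa [sub_add_cancel] at this

end Convergence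

/-- Localized approximation of a pair `(M, Q)`, to be thought of as the increment of a stochastic
integral after the time of the σ-algebra `𝓖` and its quadratic variation. The elementary integrals
`n k`, with quadratic variations `q k`, converge to `(M, Q)`; stopped before their quadratic
variation exceeds `R`, they become `N R k` and `V R k`, whose moments are controlled. -/
structure StoppedApprox {Ω : Type*} (𝓖 : MeasurableSpace Ω) {mΩ : MeasurableSpace Ω}
    (P : Measure Ω) (M Q : Ω → ℝ) where
  n : ℕ → Ω → ℝ
  q : ℕ → Ω → ℝ
  N : ℕ → ℕ → Ω → ℝ
  V : ℕ → ℕ → Ω → ℝ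
  tendsto_n : ∀ᵐ ω ∂P, Tendsto (fun k => n k ω) atTop (𝓝 (M ω))
  tendsto_q : ∀ᵐ ω ∂P, Tendsto (fun k => q k ω) atTop (𝓝 (Q ω))
  aestronglyMeasurable_n : ∀ k, AEStronglyMeasurable (n k) P
  aestronglyMeasurable_q : ∀ k, AEStronglyMeasurable (q k) P
  hasAllMoments_N : ∀ R k, HasAllMoments (N R k) P
  hasAllMoments_V : ∀ R k, HasAllMoments (V R k) P
  V_nonneg : ∀ R k ω, 0 ≤ V R k ω
  V_le : ∀ (R k : ℕ) ω, V R k ω ≤ min (q k ω) R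
  N_eq : ∀ {R k : ℕ} {ω}, q k ω ≤ R → N R k ω = n k ω
  V_eq : ∀ {R k : ℕ} {ω}, q k ω ≤ R → V R k ω = q k ω
  setIntegral_N : ∀ {A}, MeasurableSet[𝓖] A → ∀ R k, ∫ ω in A, N R k ω ∂P = 0
  setIntegral_N_sq : ∀ {A}, MeasurableSet[𝓖] A → ∀ R k,
    ∫ ω in A, N R k ω ^ 2 ∂P = ∫ ω in A, V R k ω ∂P
  setIntegral_N_pow_four_le : ∀ {A}, MeasurableSet[𝓖] A → ∀ R k,
    ∫ ω in A, N R k ω ^ 4 ∂P ≤ 30 * ∫ ω in A, V R k ω ^ 2 ∂P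

namespace StoppedApprox

variable {Ω : Type*} {𝓖 : MeasurableSpace Ω} {mΩ : MeasurableSpace Ω} {P : Measure Ω}
  {M Q : Ω → ℝ} (T : StoppedApprox 𝓖 P M Q) {A : Set Ω}

lemma q_nonneg (k : ℕ) (ω : Ω) : 0 ≤ T.q k ω :=
  (T.V_nonneg 0 k ω).trans ((T.V_le 0 k ω).trans (min_le_left _ _))

lemma ae_nonneg (T : StoppedApprox 𝓖 P M Q) : ∀ᵐ ω ∂P, 0 ≤ Q ω := by
  filter_upwards [T.tendsto_q] with ω h
  exact ge_of_tendsto' h fun k => T.q_nonneg k ω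

lemma aestronglyMeasurable_left (T : StoppedApprox 𝓖 P M Q) : AEStronglyMeasurable M P :=
  aestronglyMeasurable_of_tendsto_ae atTop T.aestronglyMeasurable_n T.tendsto_n

variable [IsFiniteMeasure P]

lemma lintegral_N_pow_four_le (hA : MeasurableSet[𝓖] A) (R k : ℕ) :
    ∫⁻ ω in A, ENNReal.ofReal (T.N R k ω ^ 4) ∂P ≤
      30 * ∫⁻ ω in A, ENNReal.ofReal (min (T.q k ω) R ^ 2) ∂P := by
  rw [← ofReal_integral_eq_lintegral_ofReal ((T.hasAllMoments_N R k).pow 4).integrable.integrableOn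
    (ae_of_all _ fun ω => by positivity)]
  refine (ENNReal.ofReal_le_ofReal (T.setIntegral_N_pow_four_le hA R k)).trans ?_
  rw [ENNReal.ofReal_mul (by norm_num), ENNReal.ofReal_ofNat,
    ofReal_integral_eq_lintegral_ofReal ((T.hasAllMoments_V R k).pow 2).integrable.integrableOn
    (ae_of_all _ fun ω => by positivity)]
  gcongr with ω
  · exact T.V_nonneg R k ω
  · exact T.V_le R k ω

lemma tendsto_lintegral_min_sq (A : Set Ω) (R : ℕ) :
    Tendsto (fun k => ∫⁻ ω in A, ENNReal.ofReal (min (T.q k ω) R ^ 2) ∂P) atTop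
      (𝓝 (∫⁻ ω in A, ENNReal.ofReal (min (Q ω) R ^ 2) ∂P)) := by
  refine tendsto_lintegral_of_dominated_convergence' (fun _ => ENNReal.ofReal ((R : ℝ) ^ 2))
    (fun k => ?_) (fun k => ae_of_all _ fun ω => ?_) ?_ ?_
  · exact (((T.aestronglyMeasurable_q k).restrict.aemeasurable.min aemeasurable_const).pow_const
      2).ennreal_ofReal
  · refine ENNReal.ofReal_le_ofReal (pow_le_pow_left₀ (le_min (T.q_nonneg k ω) R.cast_nonneg)
      (min_le_right _ _) 2)
  · rw [setLIntegral_const]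
    exact ENNReal.mul_ne_top ENNReal.ofReal_ne_top (measure_ne_top _ _)
  · filter_upwards [ae_restrict_of_ae T.tendsto_q] with ω h
    exact (ENNReal.continuous_ofReal.tendsto _).comp ((h.min tendsto_const_nhds).pow 2)

/-- The fourth moment bound, up to the time when the quadratic variation reaches `R`. -/
lemma lintegral_indicator_pow_four_le (T : StoppedApprox 𝓖 P M Q) (hA : MeasurableSet[𝓖] A)
    (R : ℕ) :
    ∫⁻ ω in A, {ω | Q ω < R}.indicator (fun ω => ENNReal.ofReal (M ω ^ 4)) ω ∂P ≤
      30 * ∫⁻ ω in A, ENNReal.ofReal (min (Q ω) R ^ 2) ∂P := by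
  have h1 : ∀ᵐ ω ∂(P.restrict A),
      {ω | Q ω < R}.indicator (fun ω => ENNReal.ofReal (M ω ^ 4)) ω ≤
        liminf (fun k => ENNReal.ofReal (T.N R k ω ^ 4)) atTop := by
    filter_upwards [ae_restrict_of_ae T.tendsto_q, ae_restrict_of_ae T.tendsto_n] with ω hq hn
    by_cases h : Q ω < R
    · rw [Set.indicator_of_mem (show ω ∈ {ω | Q ω < R} from h)]
      refine le_of_eq (Tendsto.liminf_eq ?_).symm
      refine ((ENNReal.continuous_ofReal.tendsto _).comp (hn.pow 4)).congr' ?_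
      filter_upwards [hq.eventually_lt_const h] with k hk
      simp only [Function.comp_apply, T.N_eq hk.le]
    · rw [Set.indicator_of_notMem (show ω ∉ {ω | Q ω < R} from h)]
      exact zero_le
  calc _ ≤ ∫⁻ ω in A, liminf (fun k => ENNReal.ofReal (T.N R k ω ^ 4)) atTop ∂P :=
        lintegral_mono_ae h1
    _ ≤ liminf (fun k => ∫⁻ ω in A, ENNReal.ofReal (T.N R k ω ^ 4) ∂P) atTop :=
        lintegral_liminf_le' fun k => (((T.hasAllMoments_N R k).integrable.1.aemeasurable.pow_const
          4).ennreal_ofReal).restrict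
    _ ≤ liminf (fun k => 30 * ∫⁻ ω in A, ENNReal.ofReal (min (T.q k ω) R ^ 2) ∂P) atTop :=
        liminf_le_liminf (Eventually.of_forall fun k => T.lintegral_N_pow_four_le hA R k)
    _ = _ := (ENNReal.Tendsto.const_mul (T.tendsto_lintegral_min_sq A R)
        (Or.inr (by norm_num))).liminf_eq

/-- If the quadratic variation is square integrable on `A`, then the martingale property and the
Itô isometry hold on `A`. -/
lemma isometry (T : StoppedApprox 𝓖 P M Q) (hA : MeasurableSet[𝓖] A)
    (hfin : ∫⁻ ω in A, ENNReal.ofReal (Q ω ^ 2) ∂P ≠ ∞) :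
    IntegrableOn (fun ω => M ω ^ 2) A P ∧ IntegrableOn Q A P ∧ ∫ ω in A, M ω ∂P = 0 ∧
      ∫ ω in A, M ω ^ 2 ∂P = ∫ ω in A, Q ω ∂P := by
  set C := ∫⁻ ω in A, ENNReal.ofReal (Q ω ^ 2) ∂P
  have hk : ∀ R : ℕ, ∃ k, R ≤ k ∧
      ∫⁻ ω in A, ENNReal.ofReal (min (T.q k ω) R ^ 2) ∂P ≤ C + 1 := by
    intro R
    have h1 : ∫⁻ ω in A, ENNReal.ofReal (min (Q ω) R ^ 2) ∂P < C + 1 := by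
      refine lt_of_le_of_lt (lintegral_mono_ae ?_) (ENNReal.lt_add_right hfin one_ne_zero)
      filter_upwards [ae_restrict_of_ae T.ae_nonneg] with ω h
      exact ENNReal.ofReal_le_ofReal
        (pow_le_pow_left₀ (le_min h R.cast_nonneg) (min_le_left _ _) 2)
    obtain ⟨k, h2, h3⟩ := (((T.tendsto_lintegral_min_sq A R).eventually_lt_const h1).and
      (eventually_ge_atTop R)).exists
    exact ⟨k, h3, h2.le⟩
  -- The diagonal sequence `N R (k R)` still converges, as `q` is bounded along almost every path.
  choose k hkR hkC using hk
  have hkt : Tendsto k atTop atTop := tendsto_atTop_mono hkR tendsto_id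
  have hev : ∀ᵐ ω ∂(P.restrict A), ∀ᶠ R : ℕ in atTop, T.q (k R) ω ≤ R := by
    filter_upwards [ae_restrict_of_ae T.tendsto_q] with ω hq
    filter_upwards [(hq.comp hkt).eventually_lt_const (lt_add_one (Q ω)),
      eventually_ge_atTop ⌈Q ω + 1⌉₊] with R h1 h2
    exact h1.le.trans ((Nat.le_ceil _).trans (Nat.cast_le.2 h2))
  have hN : ∀ᵐ ω ∂(P.restrict A), Tendsto (fun R => T.N R (k R) ω) atTop (𝓝 (M ω)) := by
    filter_upwards [ae_restrict_of_ae T.tendsto_n, hev] with ω hn he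
    refine (hn.comp hkt).congr' ?_
    filter_upwards [he] with R h using (T.N_eq h).symm
  have hV : ∀ᵐ ω ∂(P.restrict A), Tendsto (fun R => T.V R (k R) ω) atTop (𝓝 (Q ω)) := by
    filter_upwards [ae_restrict_of_ae T.tendsto_q, hev] with ω hn he
    refine (hn.comp hkt).congr' ?_
    filter_upwards [he] with R h using (T.V_eq h).symm
  have bV : ∀ R, ∫⁻ ω in A, ENNReal.ofReal (T.V R (k R) ω ^ 2) ∂P ≤ C + 1 := fun R =>
    (lintegral_mono fun ω => ENNReal.ofReal_le_ofReal
      (pow_le_pow_left₀ (T.V_nonneg _ _ _) (T.V_le _ _ _) 2)).trans (hkC R)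
  have b4 : ∀ R, ∫⁻ ω in A, ENNReal.ofReal (T.N R (k R) ω ^ 4) ∂P ≤ 30 * (C + 1) := fun R =>
    (T.lintegral_N_pow_four_le hA R (k R)).trans (by gcongr; exact hkC R)
  have b4' : ∀ R, ∫⁻ ω in A, ENNReal.ofReal ((T.N R (k R) ω ^ 2) ^ 2) ∂P ≤ 30 * (C + 1) := by
    intro R
    simpa only [← pow_mul] using b4 R
  have b2 : ∀ R, ∫⁻ ω in A, ENNReal.ofReal (T.N R (k R) ω ^ 2) ∂P ≤ P A + 30 * (C + 1) := by
    intro R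
    calc _ ≤ ∫⁻ ω in A, (1 + ENNReal.ofReal (T.N R (k R) ω ^ 4)) ∂P := by
          refine lintegral_mono fun ω => ?_
          rw [← ENNReal.ofReal_one, ← ENNReal.ofReal_add zero_le_one (by positivity)]
          exact ENNReal.ofReal_le_ofReal (by nlinarith [sq_nonneg (T.N R (k R) ω ^ 2 - 1)])
      _ = P A + ∫⁻ ω in A, ENNReal.ofReal (T.N R (k R) ω ^ 4) ∂P := by
          rw [lintegral_add_left measurable_const]; simp
      _ ≤ _ := by gcongr; exact b4 R
  have hC1 : C + 1 ≠ ∞ := by simp [hfin]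
  have hC30 : 30 * (C + 1) ≠ ∞ := ENNReal.mul_ne_top (by norm_num) hC1
  have mN : ∀ R, AEStronglyMeasurable (T.N R (k R)) (P.restrict A) :=
    fun R => (T.hasAllMoments_N R (k R)).integrable.1.restrict
  obtain ⟨iV, tV⟩ := tendsto_integral_of_sq_bounded hC1
    (fun R => (T.hasAllMoments_V R (k R)).integrable.1.restrict) bV hV
  obtain ⟨-, tN⟩ := tendsto_integral_of_sq_bounded
    (ENNReal.add_ne_top.2 ⟨measure_ne_top P A, hC30⟩) mN b2 hN
  obtain ⟨i2, t2⟩ := tendsto_integral_of_sq_bounded hC30 (fun R => (mN R).pow 2) b4'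
    (hN.mono fun ω h => h.pow 2)
  refine ⟨i2, iV, ?_, ?_⟩
  · refine tendsto_nhds_unique tN ?_
    simp only [T.setIntegral_N hA]
    exact tendsto_const_nhds
  · refine tendsto_nhds_unique t2 (tV.congr fun R => ?_)
    exact (T.setIntegral_N_sq hA R (k R)).symm

end StoppedApprox

/-! ### Localized approximation of Itô integrals -/

section ProgressiveMeasurability

variable {Ω : Type*} {mΩ : MeasurableSpace Ω} {F : Filtration ℝ≥0 mΩ} {H : ℝ≥0 → Ω → ℝ}

/-- A progressive process, frozen at time `T`, is jointly measurable on `ℝ × Ω`. -/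
lemma measurable_progressive (hH : IsStronglyProgressive F H) (T : ℝ≥0) :
    Measurable fun p : ℝ × Ω => H (min p.1.toNNReal T) p.2 := by
  have h1 : Measurable[Subtype.instMeasurableSpace.prod mΩ]
      fun p : Set.Iic T × Ω => H p.1 p.2 :=
    ((hH T).measurable).mono (sup_le_sup le_rfl (MeasurableSpace.comap_mono (F.le T))) le_rfl
  have h2 : Measurable fun p : ℝ × Ω =>
      ((⟨min p.1.toNNReal T, Set.mem_Iic.2 (min_le_right _ _)⟩, p.2) : Set.Iic T × Ω) := by fun_prop
  exact h1.comp h2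

lemma measurable_path (hH : IsStronglyProgressive F H) (T : ℝ≥0) (ω : Ω) :
    Measurable fun u : ℝ => H (min u.toNNReal T) ω :=
  (measurable_progressive hH T).comp measurable_prodMk_right

lemma aestronglyMeasurable_path (hH : IsStronglyProgressive F H) (s t : ℝ≥0) (ω : Ω) :
    AEStronglyMeasurable (fun u : ℝ => H u.toNNReal ω) (volume.restrict (Set.Ioc (s : ℝ) t)) := by
  refine (measurable_path hH t ω).aestronglyMeasurable.congr ?_
  filter_upwards [ae_restrict_mem measurableSet_Ioc] with u hu
  rw [min_eq_left (Real.toNNReal_le_iff_le_coe.2 hu.2)]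

end ProgressiveMeasurability

/-- The quadratic variation `∫_s^t H_u² du` of the stochastic integral of `H` over `(s, t]`. -/
noncomputable def quadVar {Ω : Type*} (H : ℝ≥0 → Ω → ℝ) (s t : ℝ≥0) (ω : Ω) : ℝ≥0∞ :=
  ∫⁻ u in Set.Ioc (s : ℝ) t, ENNReal.ofReal (H u.toNNReal ω ^ 2)

lemma quadVar_le_sqDist {Ω : Type*} (H : ℝ≥0 → Ω → ℝ) (s t : ℝ≥0) (ω : Ω) :
    quadVar H s t ω ≤ sqDist H 0 t ω := by
  simp only [quadVar, sqDist, Pi.zero_apply, sub_zero]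
  exact lintegral_mono_set (Set.Ioc_subset_Icc_self.trans (Set.Icc_subset_Icc_left s.coe_nonneg))

namespace IsItoIntegral

variable {Ω : Type*} {mΩ : MeasurableSpace Ω} {P : Measure Ω} {F : Filtration ℝ≥0 mΩ}
  {B H I : ℝ≥0 → Ω → ℝ}

lemma ae_quadVar_ne_top (hI : IsItoIntegral P F B H I) :
    ∀ᵐ ω ∂P, ∀ s t : ℝ≥0, quadVar H s t ω ≠ ∞ := by
  filter_upwards [hI.sq_integrable] with ω h s t
  exact ((quadVar_le_sqDist H s t ω).trans_lt (h t)).ne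

/-- Along a subsequence, the approximating simple processes converge almost surely. -/
lemma exists_simple_ae_tendsto (hI : IsItoIntegral P F B H I) (s t : ℝ≥0) :
    ∃ S : ℕ → SimpleProcess F,
      (∀ᵐ ω ∂P, Tendsto (fun k => sqDist (S k).value H t ω) atTop (𝓝 0)) ∧
      (∀ᵐ ω ∂P, Tendsto (fun k => (S k).integral B s ω) atTop (𝓝 (I s ω))) ∧
      (∀ᵐ ω ∂P, Tendsto (fun k => (S k).integral B t ω) atTop (𝓝 (I t ω))) := by
  obtain ⟨S, hS⟩ := hI.approx
  -- Convergence in probability of the distances is applied to their truncations at `1`.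
  have hD : TendstoInMeasure P (fun k ω => (min (sqDist (S k).value H t ω) 1).toReal) atTop
      (fun _ => (0 : ℝ)) := by
    rw [tendstoInMeasure_iff_norm]
    intro ε hε
    refine tendsto_of_tendsto_of_tendsto_of_le_of_le tendsto_const_nhds
      ((hS t).1 (ENNReal.ofReal ε) (ENNReal.ofReal_pos.2 hε)) (fun _ => zero_le)
      fun k => measure_mono fun ω hω => ?_
    simp only [Set.mem_ofPred_eq, sub_zero, Real.norm_eq_abs, abs_of_nonneg ENNReal.toReal_nonneg]
      at hω ⊢
    exact (ENNReal.ofReal_le_of_le_toReal hω).trans (min_le_left _ _)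
  obtain ⟨a, ha, ha'⟩ := hD.exists_seq_tendsto_ae
  obtain ⟨b, hb, hb'⟩ := ((hS s).2.comp ha.tendsto_atTop).exists_seq_tendsto_ae
  obtain ⟨c, hc, hc'⟩ :=
    ((hS t).2.comp (ha.tendsto_atTop.comp hb.tendsto_atTop)).exists_seq_tendsto_ae
  refine ⟨fun k => S (a (b (c k))), ?_, ?_, ?_⟩
  · filter_upwards [ha'] with ω h
    have h1 := h.comp (hb.tendsto_atTop.comp hc.tendsto_atTop)
    have h2 : Tendsto (fun k => min (sqDist (S (a (b (c k)))).value H t ω) 1) atTop (𝓝 0) := by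
      rw [← ENNReal.tendsto_toReal_iff (fun k => ne_top_of_le_ne_top ENNReal.one_ne_top
        (min_le_right _ _)) ENNReal.zero_ne_top]
      exact h1
    refine h2.congr' ?_
    filter_upwards [h2.eventually_lt_const zero_lt_one] with k hk
    exact min_eq_left (by simpa using (min_lt_iff.1 hk).resolve_right (lt_irrefl _) |>.le)
  · filter_upwards [hb'] with ω h using h.comp hc.tendsto_atTop
  · filter_upwards [hc'] with ω h using h

/-- The increment of a stochastic integral over `(s, t]`, with its quadratic variation, has a
localized approximation relative to the past of time `s`. -/
lemma nonempty_stoppedApprox [IsFiniteMeasure P] (hI : IsItoIntegral P F B H I)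
    (hB : IsBrownianMotionWrt P F B) {s t : ℝ≥0} (hst : s ≤ t) :
    Nonempty (StoppedApprox (F s) P (fun ω => I t ω - I s ω)
      (fun ω => (quadVar H s t ω).toReal)) := by
  obtain ⟨S, hD, hs, ht⟩ := hI.exists_simple_ae_tendsto s t
  let U : ℕ → SimpleProcess F := fun k => (S k).restrict s t
  have hA : ∀ {A : Set Ω}, MeasurableSet[F s] A → ∀ R k,
      MeasurableSet[F (((U k).cutoff R).time 0)] A := fun hA R k => F.mono (le_max_left _ _) _ hA
  have hB' := hB.adapted
  exact ⟨{
    n := fun k => (U k).sumUpTo B (S k).len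
    q := fun k => (U k).varUpTo (S k).len
    N := fun R k => ((U k).cutoff R).sumUpTo B (S k).len
    V := fun R k => ((U k).cutoff R).varUpTo (S k).len
    tendsto_n := by
      filter_upwards [hs, ht] with ω h1 h2
      simpa only [U, SimpleProcess.sumUpTo_restrict _ hst] using h2.sub h1
    tendsto_q := by
      filter_upwards [hD, hI.ae_quadVar_ne_top] with ω h1 h2
      have h3 : Tendsto (fun k => ENNReal.ofReal ((U k).varUpTo (S k).len ω)) atTop
          (𝓝 (quadVar H s t ω)) := by
        simp only [U, ← SimpleProcess.lintegral_value_sq _ hst]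
        refine tendsto_lintegral_sq
          (fun k => ((S k).measurable_value ω).aestronglyMeasurable)
          (aestronglyMeasurable_path hI.progressive s t ω) (h2 s t) ?_
        refine tendsto_of_tendsto_of_tendsto_of_le_of_le tendsto_const_nhds h1
          (fun _ => zero_le) fun k => lintegral_mono_set
            (Set.Ioc_subset_Icc_self.trans (Set.Icc_subset_Icc_left s.coe_nonneg))
      have h4 := (ENNReal.tendsto_toReal (h2 s t)).comp h3
      refine h4.congr fun k => ?_
      exact ENNReal.toReal_ofReal ((U k).varUpTo_nonneg _ ω)
    aestronglyMeasurable_n := fun k =>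
      (((U k).stronglyMeasurable_sumUpTo hB' _).mono (F.le _)).aestronglyMeasurable
    aestronglyMeasurable_q := fun k =>
      (((U k).stronglyMeasurable_varUpTo _).mono (F.le _)).aestronglyMeasurable
    hasAllMoments_N := fun R k => SimpleProcess.hasAllMoments_sumUpTo _ hB _
    hasAllMoments_V := fun R k => SimpleProcess.hasAllMoments_varUpTo _ _
    V_nonneg := fun R k ω => SimpleProcess.varUpTo_nonneg _ _ ω
    V_le := fun R k ω => le_min (SimpleProcess.varUpTo_cutoff_le _ _ _ ω)
      (SimpleProcess.varUpTo_cutoff_le_level _ R.cast_nonneg _ ω)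
    N_eq := fun h => SimpleProcess.sumUpTo_cutoff _ h
    V_eq := fun h => SimpleProcess.varUpTo_cutoff _ h
    setIntegral_N := fun h R k => SimpleProcess.setIntegral_sumUpTo hB (hA h R k) _
    setIntegral_N_sq := fun h R k => SimpleProcess.setIntegral_sumUpTo_sq hB (hA h R k) _
    setIntegral_N_pow_four_le := fun h R k =>
      SimpleProcess.setIntegral_sumUpTo_pow_four_le hB (hA h R k) _ }⟩

end IsItoIntegral

/-! ### Tools for Grönwall arguments -/

section Gronwall

/-- A Grönwall inequality on an interval of length one. Only boundedness of `G` is needed, as `G`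
is compared with the supremum of `G t * exp (-2 c (t - s))`. -/
lemma le_of_le_add_lintegral {G : ℝ → ℝ≥0∞} {s c : ℝ} (hc : 0 < c) {a C : ℝ≥0∞} (hC : C ≠ ∞)
    (hbd : ∀ t ∈ Set.Icc s (s + 1), G t ≤ C)
    (hG : ∀ t ∈ Set.Icc s (s + 1), G t ≤ a + ENNReal.ofReal c * ∫⁻ u in Set.Ioc s t, G u) :
    ∀ t ∈ Set.Icc s (s + 1), G t ≤ 2 * a * ENNReal.ofReal (Real.exp (2 * c)) := by
  let e : ℝ → ℝ := fun t => Real.exp (2 * c * (t - s))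
  have epos : ∀ t, 0 < e t := fun t => Real.exp_pos _
  let b : ℝ≥0∞ := ⨆ t ∈ Set.Icc s (s + 1), G t * ENNReal.ofReal (e t)⁻¹
  have hb : ∀ t ∈ Set.Icc s (s + 1), G t ≤ b * ENNReal.ofReal (e t) := by
    intro t ht
    have h1 : G t * ENNReal.ofReal (e t)⁻¹ ≤ b :=
      le_iSup₂ (f := fun t (_ : t ∈ Set.Icc s (s + 1)) => G t * ENNReal.ofReal (e t)⁻¹) t ht
    calc G t = G t * ENNReal.ofReal (e t)⁻¹ * ENNReal.ofReal (e t) := by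
          rw [mul_assoc, ← ENNReal.ofReal_mul (inv_nonneg.2 (epos t).le),
            inv_mul_cancel₀ (epos t).ne', ENNReal.ofReal_one, mul_one]
      _ ≤ _ := by gcongr
  have hbC : b ≤ C := by
    refine iSup₂_le fun t ht => ?_
    have : (e t)⁻¹ ≤ 1 := inv_le_one_of_one_le₀
      (Real.one_le_exp (mul_nonneg (by positivity) (sub_nonneg.2 ht.1)))
    calc _ ≤ C * ENNReal.ofReal 1 :=
          mul_le_mul' (hbd t ht) (ENNReal.ofReal_le_ofReal this)
      _ = C := by simp
  have hbtop : b ≠ ∞ := ne_top_of_le_ne_top hC hbC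
  have hint : ∀ t ∈ Set.Icc s (s + 1), ∫⁻ u in Set.Ioc s t, ENNReal.ofReal (e u) ≤
      ENNReal.ofReal (e t / (2 * c)) := by
    intro t ht
    have hcont : Continuous e := by fun_prop
    have hd : ∀ u, HasDerivAt (fun u => e u / (2 * c)) (e u) u := by
      intro u
      have h1 : HasDerivAt (fun u : ℝ => 2 * c * (u - s)) (2 * c * 1) u :=
        ((hasDerivAt_id u).sub_const s).const_mul (2 * c)
      have h2 := h1.exp.div_const (2 * c)
      convert! h2 using 1
      simp only [e]
      field_simp
    rw [← ofReal_integral_eq_lintegral_ofReal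
      (hcont.integrableOn_Icc.mono_set Set.Ioc_subset_Icc_self)
      (ae_of_all _ fun u => (epos u).le), ← intervalIntegral.integral_of_le ht.1,
      intervalIntegral.integral_eq_sub_of_hasDerivAt (fun u _ => hd u)
        (hcont.intervalIntegrable _ _)]
    refine ENNReal.ofReal_le_ofReal (sub_le_self _ (div_nonneg (epos _).le (by positivity)))
  have hstep : b ≤ a + b / 2 := by
    refine iSup₂_le fun t ht => ?_
    have h1 : ENNReal.ofReal c * ∫⁻ u in Set.Ioc s t, G u ≤ b / 2 * ENNReal.ofReal (e t) := by
      calc _ ≤ ENNReal.ofReal c * ∫⁻ u in Set.Ioc s t, b * ENNReal.ofReal (e u) := by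
            gcongr ENNReal.ofReal c * ?_
            exact setLIntegral_mono' measurableSet_Ioc
              fun u hu => hb u ⟨hu.1.le, hu.2.trans ht.2⟩
        _ ≤ ENNReal.ofReal c * (b * ENNReal.ofReal (e t / (2 * c))) := by
            rw [lintegral_const_mul' _ _ hbtop]
            gcongr
            exact hint t ht
        _ = b * (ENNReal.ofReal c * ENNReal.ofReal (e t / (2 * c))) := by ring
        _ = b / 2 * ENNReal.ofReal (e t) := by
            rw [← ENNReal.ofReal_mul hc.le,
              show c * (e t / (2 * c)) = 2⁻¹ * e t by field_simp,
              ENNReal.ofReal_mul (by norm_num), ENNReal.ofReal_inv_of_pos (by norm_num),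
              ENNReal.ofReal_ofNat, ← mul_assoc, div_eq_mul_inv]
    have h2 : (e t)⁻¹ ≤ 1 := inv_le_one_of_one_le₀
      (Real.one_le_exp (mul_nonneg (by positivity) (sub_nonneg.2 ht.1)))
    calc G t * ENNReal.ofReal (e t)⁻¹
        ≤ (a + b / 2 * ENNReal.ofReal (e t)) * ENNReal.ofReal (e t)⁻¹ := by
          gcongr
          exact (hG t ht).trans (by gcongr)
      _ = a * ENNReal.ofReal (e t)⁻¹ + b / 2 := by
          rw [add_mul, mul_assoc (b / 2), ← ENNReal.ofReal_mul (epos t).le,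
            mul_inv_cancel₀ (epos t).ne', ENNReal.ofReal_one, mul_one]
      _ ≤ a * 1 + b / 2 := by
          gcongr
          exact ENNReal.ofReal_le_one.2 h2
      _ = _ := by rw [mul_one]
  have hb2 : b ≤ 2 * a := by
    have h2 : b / 2 + b / 2 ≤ a + b / 2 := by rwa [ENNReal.add_halves]
    have h3 := (ENNReal.add_le_add_iff_right
      (ENNReal.div_ne_top hbtop two_ne_zero)).1 h2
    calc b = b / 2 + b / 2 := (ENNReal.add_halves b).symm
      _ ≤ a + a := add_le_add h3 h3
      _ = 2 * a := (two_mul a).symm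
  intro t ht
  refine (hb t ht).trans ?_
  gcongr
  have : t - s ≤ 1 := by linarith [ht.2]
  simp only [e]
  exact Real.exp_le_exp.2 (by nlinarith)

/-- The integral of a continuous nonnegative function, cut off at level `R`, is at most the
integral over the times before level `R` is reached. -/
lemma ofReal_min_integral_le {w : ℝ → ℝ} (hw : Continuous w) (h0 : ∀ u, 0 ≤ w u) {s t : ℝ}
    (hst : s ≤ t) (R : ℝ) : ENNReal.ofReal (min (∫ u in s..t, w u) R) ≤
      ∫⁻ u in Set.Ioc s t,
        {u | ∫ x in s..u, w x < R}.indicator (fun u => ENNReal.ofReal (w u)) u := by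
  have hmono : ∀ {x y}, s ≤ x → x ≤ y → ∫ u in s..x, w u ≤ ∫ u in s..y, w u := by
    intro x y hx hxy
    exact intervalIntegral.integral_mono_interval le_rfl hx hxy (ae_of_all _ h0)
      (hw.intervalIntegrable _ _)
  refine le_of_forall_lt_imp_le_of_dense fun c hc => ?_
  have hctop : c ≠ ∞ := hc.ne_top
  have hc' : c.toReal < min (∫ u in s..t, w u) R := (ENNReal.lt_ofReal_iff_toReal_lt hctop).1 hc
  obtain ⟨τ, hτ, hτ'⟩ := intermediate_value_Icc hst
    (intervalIntegral.continuous_primitive (fun a b => hw.intervalIntegrable a b) s).continuousOn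
    (show c.toReal ∈ Set.Icc (∫ u in s..s, w u) (∫ u in s..t, w u) from
      ⟨by simp, (hc'.trans_le (min_le_left _ _)).le⟩)
  calc c = ENNReal.ofReal (∫ u in s..τ, w u) := by
        simp only at hτ'
        rw [hτ', ENNReal.ofReal_toReal hctop]
    _ = ∫⁻ u in Set.Ioc s τ, ENNReal.ofReal (w u) := by
        rw [intervalIntegral.integral_of_le hτ.1, ofReal_integral_eq_lintegral_ofReal
          (hw.integrableOn_Icc.mono_set Set.Ioc_subset_Icc_self) (ae_of_all _ h0)]
    _ ≤ ∫⁻ u in Set.Ioc s τ,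
        {u | ∫ x in s..u, w x < R}.indicator (fun u => ENNReal.ofReal (w u)) u := by
        refine setLIntegral_mono' measurableSet_Ioc fun u hu => ?_
        have : ∫ x in s..u, w x < R := by
          refine (hmono hu.1.le hu.2).trans_lt ?_
          simp only at hτ'
          rw [hτ']
          exact hc'.trans_le (min_le_right _ _)
        rw [Set.indicator_of_mem (show u ∈ {u | ∫ x in s..u, w x < R} from this)]
    _ ≤ _ := lintegral_mono_set (Set.Ioc_subset_Ioc_right hτ.2)

/-- The Cauchy-Schwarz inequality against the constant function `1`. -/
lemma sq_lintegral_le {α : Type*} {mα : MeasurableSpace α} {μ : Measure α} (hμ : μ Set.univ ≤ 1)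
    {f : α → ℝ≥0∞} (hf : AEMeasurable f μ) : (∫⁻ x, f x ∂μ) ^ 2 ≤ ∫⁻ x, f x ^ 2 ∂μ := by
  have h := ENNReal.lintegral_mul_le_Lp_mul_Lq μ Real.HolderConjugate.two_two hf
    (aemeasurable_const (b := (1 : ℝ≥0∞)))
  simp only [Pi.mul_apply, mul_one, ENNReal.one_rpow, lintegral_const, one_mul] at h
  have h1 : μ Set.univ ^ (1 / 2 : ℝ) ≤ 1 := ENNReal.rpow_le_one hμ (by norm_num)
  calc (∫⁻ x, f x ∂μ) ^ 2 ≤ ((∫⁻ x, f x ^ (2 : ℝ) ∂μ) ^ (1 / 2 : ℝ) * 1) ^ 2 := by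
        gcongr
        exact h.trans (by gcongr)
    _ = ∫⁻ x, f x ^ 2 ∂μ := by
        rw [mul_one, ← ENNReal.rpow_natCast, ← ENNReal.rpow_mul]
        norm_num

end Gronwall

section JointMeasurability

variable {Ω : Type*} {mΩ : MeasurableSpace Ω} {F : Filtration ℝ≥0 mΩ} {H : ℝ≥0 → Ω → ℝ}

lemma measurable_uncurry_progressive (hH : IsStronglyProgressive F H) :
    Measurable fun p : ℝ × Ω => H p.1.toNNReal p.2 := by
  refine measurable_of_tendsto_metrizable (fun n : ℕ => measurable_progressive hH n)
    (tendsto_pi_nhds.2 fun p => tendsto_nhds_of_eventually_eq ?_)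
  filter_upwards [eventually_ge_atTop ⌈p.1.toNNReal⌉₊] with n hn
  rw [min_eq_left ((Nat.le_ceil _).trans (Nat.cast_le.2 hn))]

lemma measurable_quadVar (hH : IsStronglyProgressive F H) (s : ℝ≥0) :
    Measurable fun p : ℝ × Ω => quadVar H s p.1.toNNReal p.2 := by
  have h : ∀ p : ℝ × Ω, quadVar H s p.1.toNNReal p.2 =
      ∫⁻ u, {q : (ℝ × Ω) × ℝ | (s : ℝ) < q.2 ∧ q.2 ≤ (q.1.1.toNNReal : ℝ)}.indicator
        (fun q => ENNReal.ofReal (H q.2.toNNReal q.1.2 ^ 2)) (p, u) := by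
    intro p
    rw [quadVar, ← lintegral_indicator measurableSet_Ioc]
    rfl
  simp only [h]
  refine Measurable.lintegral_prod_right' (f := Set.indicator _ _) ?_
  refine Measurable.indicator ?_ ?_
  · have h1 := (measurable_uncurry_progressive hH).comp
      (measurable_snd.prodMk (measurable_snd.comp measurable_fst) :
        Measurable fun q : (ℝ × Ω) × ℝ => (q.2, q.1.2))
    exact (h1.pow_const 2).ennreal_ofReal
  · exact (measurableSet_lt measurable_const measurable_snd).inter
      (measurableSet_le measurable_snd (by fun_prop))

end JointMeasurability

/-! ### One day of the variance dynamics -/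

/-- On the day `[s, s + 1]` the squared volatility is `v + (t - s) a + β (∫_s^t σ dB)²`, with `v`
and `a` known at time `s`. -/
structure IsVarianceDay {Ω : Type*} {mΩ : MeasurableSpace Ω} (P : Measure Ω)
    (F : Filtration ℝ≥0 mΩ) (β : ℝ) (B σ I : ℝ≥0 → Ω → ℝ) (s : ℝ≥0) (v a : Ω → ℝ) : Prop where
  brownian : IsBrownianMotionWrt P F B
  ito : IsItoIntegral P F B σ I
  continuous_sq : ∀ᵐ ω ∂P, Continuous fun t => σ t ω ^ 2
  measurable_v : StronglyMeasurable[F s] v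
  measurable_a : StronglyMeasurable[F s] a
  sq_eq : ∀ᵐ ω ∂P, ∀ t ∈ Set.Icc s (s + 1),
    σ t ω ^ 2 = v ω + ((t : ℝ) - s) * a ω + β * (I t ω - I s ω) ^ 2

lemma quadVar_eq_ofReal {Ω : Type*} {H : ℝ≥0 → Ω → ℝ} {ω : Ω}
    (hH : Continuous fun t => H t ω ^ 2) {s t : ℝ≥0} (hst : s ≤ t) :
    quadVar H s t ω = ENNReal.ofReal (∫ u in (s : ℝ)..t, H u.toNNReal ω ^ 2) := by
  have hw : Continuous fun u : ℝ => H u.toNNReal ω ^ 2 := hH.comp continuous_real_toNNReal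
  rw [intervalIntegral.integral_of_le (NNReal.coe_le_coe.2 hst),
    ofReal_integral_eq_lintegral_ofReal
      (hw.integrableOn_Icc.mono_set Set.Ioc_subset_Icc_self) (ae_of_all _ fun u => sq_nonneg _)]
  rfl

/-- A Grönwall majorant for the second moment of the quadratic variation. -/
lemma ofReal_min_quadVar_sq_le {Ω : Type*} {H : ℝ≥0 → Ω → ℝ} {ω : Ω}
    (hH : Continuous fun t => H t ω ^ 2) {s t : ℝ≥0} (hst : s ≤ t) (ht : t ≤ s + 1) (R : ℕ) :
    ENNReal.ofReal (min (quadVar H s t ω).toReal R ^ 2) ≤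
      ∫⁻ u in Set.Ioc (s : ℝ) t, {u : ℝ | (quadVar H s u.toNNReal ω).toReal < R}.indicator
        (fun u => ENNReal.ofReal (H u.toNNReal ω ^ 4)) u := by
  have hw : Continuous fun u : ℝ => H u.toNNReal ω ^ 2 := hH.comp continuous_real_toNNReal
  have h0 : ∀ u : ℝ, 0 ≤ H u.toNNReal ω ^ 2 := fun u => sq_nonneg _
  have hst' : (s : ℝ) ≤ t := NNReal.coe_le_coe.2 hst
  have hq : ∀ u : ℝ, (s : ℝ) ≤ u →
      (quadVar H s u.toNNReal ω).toReal = ∫ x in (s : ℝ)..u, H x.toNNReal ω ^ 2 := by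
    intro u hu
    have h1 : s ≤ u.toNNReal := NNReal.le_toNNReal_of_coe_le hu
    rw [quadVar_eq_ofReal hH h1, Real.coe_toNNReal u (s.coe_nonneg.trans hu),
      ENNReal.toReal_ofReal (intervalIntegral.integral_nonneg hu fun x _ => h0 x)]
  have hqt : (quadVar H s t ω).toReal = ∫ x in (s : ℝ)..t, H x.toNNReal ω ^ 2 := by
    simpa using hq t hst'
  have h0m : 0 ≤ min (∫ x in (s : ℝ)..t, H x.toNNReal ω ^ 2) (R : ℝ) :=
    le_min (intervalIntegral.integral_nonneg hst' fun x _ => h0 x) R.cast_nonneg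
  have hcont := intervalIntegral.continuous_primitive (μ := volume)
    (fun a b => hw.intervalIntegrable a b) s
  have hmeas : MeasurableSet {u : ℝ | ∫ x in (s : ℝ)..u, H x.toNNReal ω ^ 2 < R} :=
    (isOpen_lt hcont continuous_const).measurableSet
  have hvol : (volume.restrict (Set.Ioc (s : ℝ) t)) Set.univ ≤ 1 := by
    rw [Measure.restrict_apply_univ, Real.volume_Ioc]
    refine ENNReal.ofReal_le_one.2 ?_
    have : (t : ℝ) ≤ s + 1 := by exact_mod_cast ht
    linarith
  calc _ = ENNReal.ofReal (min (∫ x in (s : ℝ)..t, H x.toNNReal ω ^ 2) R) ^ 2 := by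
        rw [hqt, ENNReal.ofReal_pow h0m]
    _ ≤ _ := by
        gcongr
        exact ofReal_min_integral_le hw h0 hst' R
    _ ≤ _ := sq_lintegral_le hvol
        ((hw.measurable.ennreal_ofReal).indicator hmeas).aemeasurable
    _ = _ := by
        refine setLIntegral_congr_fun measurableSet_Ioc fun u hu => ?_
        have h1 := hq u hu.1.le
        simp only [Set.indicator_apply, Set.mem_ofPred_eq, h1]
        split_ifs
        · rw [← ENNReal.ofReal_pow (h0 u), ← pow_mul]
        · simp

namespace IsVarianceDay

variable {Ω : Type*} {mΩ : MeasurableSpace Ω} {P : Measure Ω} [IsProbabilityMeasure P]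
  {F : Filtration ℝ≥0 mΩ} {β : ℝ} {B σ I : ℝ≥0 → Ω → ℝ} {s : ℝ≥0} {v a : Ω → ℝ}

/-- The fourth moment of the volatility at time `u`, on `A` and before its accumulated square
reaches `R`. -/
noncomputable def truncFourthMoment (P : Measure Ω) (σ : ℝ≥0 → Ω → ℝ) (s : ℝ≥0) (A : Set Ω)
    (R : ℕ) (u : ℝ) : ℝ≥0∞ :=
  ∫⁻ ω in A, {ω | (quadVar σ s u.toNNReal ω).toReal < R}.indicator
    (fun ω => ENNReal.ofReal (σ u.toNNReal ω ^ 4)) ω ∂P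

lemma lintegral_min_quadVar_sq_le (hd : IsVarianceDay P F β B σ I s v a) (A : Set Ω) (R : ℕ)
    {t : ℝ≥0} (hst : s ≤ t) (ht : t ≤ s + 1) :
    ∫⁻ ω in A, ENNReal.ofReal (min (quadVar σ s t ω).toReal R ^ 2) ∂P ≤
      ∫⁻ u in Set.Ioc (s : ℝ) t, truncFourthMoment P σ s A R u := by
  let g : ℝ × Ω → ℝ≥0∞ := {p : ℝ × Ω | (quadVar σ s p.1.toNNReal p.2).toReal < R}.indicator
    fun p => ENNReal.ofReal (σ p.1.toNNReal p.2 ^ 4)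
  have hg : ∀ u ω, {ω | (quadVar σ s u.toNNReal ω).toReal < R}.indicator
      (fun ω => ENNReal.ofReal (σ u.toNNReal ω ^ 4)) ω = g (u, ω) := fun u ω => by
    simp only [g, Set.indicator_apply, Set.mem_ofPred_eq]
  have hmeas : Measurable g := Measurable.indicator
    ((measurable_uncurry_progressive hd.ito.progressive).pow_const 4).ennreal_ofReal
    ((measurable_quadVar hd.ito.progressive s).ennreal_toReal measurableSet_Iio)
  have hswap := lintegral_lintegral_swap (μ := volume.restrict (Set.Ioc (s : ℝ) t))
    (ν := P.restrict A) (f := fun u ω => g (u, ω)) hmeas.aemeasurable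
  simp only [truncFourthMoment, hg]
  rw [hswap]
  refine lintegral_mono_ae ?_
  filter_upwards [ae_restrict_of_ae hd.continuous_sq] with ω hω
  refine (ofReal_min_quadVar_sq_le hω hst ht R).trans (le_of_eq (lintegral_congr fun u => ?_))
  simp only [g, Set.indicator_apply, Set.mem_ofPred_eq]

/-- On an event of the past on which the day starts with bounded data, the quadratic variation of
the day is square integrable. -/
lemma lintegral_quadVar_sq_ne_top (hd : IsVarianceDay P F β B σ I s v a) {A : Set Ω}
    (hA : MeasurableSet[F s] A) {K : ℝ} (hv : ∀ ω ∈ A, |v ω| ≤ K) (ha : ∀ ω ∈ A, |a ω| ≤ K)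
    {t : ℝ≥0} (hst : s ≤ t) (ht : t ≤ s + 1) :
    ∫⁻ ω in A, ENNReal.ofReal ((quadVar σ s t ω).toReal ^ 2) ∂P ≠ ∞ := by
  have hA' := F.le _ _ hA
  -- the fourth moment bound for the integral, inserted in the formula for the volatility
  have hbd : ∀ (R : ℕ) (u : ℝ≥0), s ≤ u → u ≤ s + 1 → truncFourthMoment P σ s A R u ≤
      ENNReal.ofReal (8 * K ^ 2) + ENNReal.ofReal (60 * β ^ 2 + 1) *
        ∫⁻ ω in A, ENNReal.ofReal (min (quadVar σ s u ω).toReal R ^ 2) ∂P := by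
    intro R u hsu hu
    obtain ⟨T⟩ := hd.ito.nonempty_stoppedApprox hd.brownian hsu
    have h1 : ∀ᵐ ω ∂(P.restrict A), {ω | (quadVar σ s u ω).toReal < R}.indicator
        (fun ω => ENNReal.ofReal (σ u ω ^ 4)) ω ≤ ENNReal.ofReal (8 * K ^ 2) +
          ENNReal.ofReal (2 * β ^ 2) * {ω | (quadVar σ s u ω).toReal < R}.indicator
            (fun ω => ENNReal.ofReal ((I u ω - I s ω) ^ 4)) ω := by
      filter_upwards [ae_restrict_of_ae hd.sq_eq, ae_restrict_mem hA'] with ω hω hωA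
      simp only [Set.indicator_apply]
      split_ifs with h
      · rw [← ENNReal.ofReal_mul (by positivity), ← ENNReal.ofReal_add (by positivity)
          (by positivity)]
        refine ENNReal.ofReal_le_ofReal ?_
        have h2 := hω u ⟨hsu, hu⟩
        have h3 : |((u : ℝ) - s)| ≤ 1 := by
          have h4 : (s : ℝ) ≤ u := NNReal.coe_le_coe.2 hsu
          have h5 : (u : ℝ) ≤ s + 1 := by exact_mod_cast hu
          rw [abs_le]; constructor <;> linarith
        have h4 : |v ω + ((u : ℝ) - s) * a ω| ≤ 2 * K := by
          calc _ ≤ |v ω| + |((u : ℝ) - s)| * |a ω| := by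
                rw [← abs_mul]; exact abs_add_le _ _
            _ ≤ K + 1 * K := add_le_add (hv ω hωA)
                (mul_le_mul h3 (ha ω hωA) (abs_nonneg _) zero_le_one)
            _ = _ := by ring
        have h5 : (v ω + ((u : ℝ) - s) * a ω) ^ 2 ≤ (2 * K) ^ 2 := by
          rw [← sq_abs]; exact pow_le_pow_left₀ (abs_nonneg _) h4 2
        calc σ u ω ^ 4 = (σ u ω ^ 2) ^ 2 := by ring
          _ = (v ω + ((u : ℝ) - s) * a ω + β * (I u ω - I s ω) ^ 2) ^ 2 := by rw [h2]
          _ ≤ 2 * (v ω + ((u : ℝ) - s) * a ω) ^ 2 + 2 * (β * (I u ω - I s ω) ^ 2) ^ 2 :=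
              add_sq_le.trans (by rw [mul_add])
          _ ≤ 2 * (2 * K) ^ 2 + 2 * (β * (I u ω - I s ω) ^ 2) ^ 2 := by gcongr
          _ = _ := by ring
      · exact zero_le
    have e : truncFourthMoment P σ s A R u = ∫⁻ ω in A,
        {ω | (quadVar σ s u ω).toReal < R}.indicator
          (fun ω => ENNReal.ofReal (σ u ω ^ 4)) ω ∂P := by
      simp only [truncFourthMoment, Real.toNNReal_coe]
    rw [e]
    refine (lintegral_mono_ae h1).trans ?_
    rw [lintegral_add_left measurable_const, lintegral_const_mul' _ _ ENNReal.ofReal_ne_top,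
      setLIntegral_const]
    refine add_le_add (mul_le_of_le_one_right' prob_le_one) ?_
    calc _ ≤ ENNReal.ofReal (2 * β ^ 2) * (30 * ∫⁻ ω in A,
            ENNReal.ofReal (min (quadVar σ s u ω).toReal R ^ 2) ∂P) := by
          gcongr
          exact T.lintegral_indicator_pow_four_le hA R
      _ = ENNReal.ofReal (60 * β ^ 2) * ∫⁻ ω in A,
            ENNReal.ofReal (min (quadVar σ s u ω).toReal R ^ 2) ∂P := by
          rw [← mul_assoc, ← ENNReal.ofReal_ofNat, ← ENNReal.ofReal_mul (by positivity)]
          congr 2; ring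
      _ ≤ _ := by
          gcongr
          linarith
  set D : ℝ≥0∞ := 2 * ENNReal.ofReal (8 * K ^ 2) *
    ENNReal.ofReal (Real.exp (2 * (60 * β ^ 2 + 1))) with hD
  have hDtop : D ≠ ∞ := by
    simp only [hD]
    exact ENNReal.mul_ne_top (ENNReal.mul_ne_top (by norm_num) ENNReal.ofReal_ne_top)
      ENNReal.ofReal_ne_top
  have hcoe : ∀ u : ℝ, u ∈ Set.Icc (s : ℝ) (s + 1) →
      ∃ u' : ℝ≥0, (u' : ℝ) = u ∧ s ≤ u' ∧ u' ≤ s + 1 := by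
    intro u hu
    refine ⟨u.toNNReal, Real.coe_toNNReal u (s.coe_nonneg.trans hu.1),
      NNReal.le_toNNReal_of_coe_le hu.1, Real.toNNReal_le_iff_le_coe.2 (by simpa using hu.2)⟩
  have hG : ∀ R : ℕ, ∀ u ∈ Set.Icc (s : ℝ) (s + 1), truncFourthMoment P σ s A R u ≤ D := by
    intro R
    refine le_of_le_add_lintegral (by positivity : 0 < 60 * β ^ 2 + 1)
      (C := ENNReal.ofReal (8 * K ^ 2) +
        ENNReal.ofReal (60 * β ^ 2 + 1) * ENNReal.ofReal ((R : ℝ) ^ 2)) ?_ ?_ ?_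
    · exact ENNReal.add_ne_top.2 ⟨ENNReal.ofReal_ne_top,
        ENNReal.mul_ne_top ENNReal.ofReal_ne_top ENNReal.ofReal_ne_top⟩
    · intro u hu
      obtain ⟨u, rfl, h1, h2⟩ := hcoe u hu
      refine (hbd R u h1 h2).trans ?_
      gcongr
      calc _ ≤ ∫⁻ ω in A, ENNReal.ofReal ((R : ℝ) ^ 2) ∂P := by
            gcongr with ω
            exact min_le_right _ _
        _ ≤ _ := by
            rw [setLIntegral_const]
            exact mul_le_of_le_one_right' prob_le_one
    · intro u hu
      obtain ⟨u, rfl, h1, h2⟩ := hcoe u hu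
      refine (hbd R u h1 h2).trans ?_
      gcongr
      exact hd.lintegral_min_quadVar_sq_le A R h1 h2
  have hmin : ∀ R : ℕ,
      ∫⁻ ω in A, ENNReal.ofReal (min (quadVar σ s t ω).toReal R ^ 2) ∂P ≤ D := by
    intro R
    refine (hd.lintegral_min_quadVar_sq_le A R hst ht).trans ?_
    have ht' : (t : ℝ) ≤ s + 1 := by exact_mod_cast ht
    calc _ ≤ ∫⁻ u in Set.Ioc (s : ℝ) t, D :=
          setLIntegral_mono' measurableSet_Ioc fun u hu => hG R u ⟨hu.1.le, hu.2.trans ht'⟩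
      _ ≤ D := by
          rw [setLIntegral_const, Real.volume_Ioc]
          exact mul_le_of_le_one_right' (ENNReal.ofReal_le_one.2 (by linarith))
  have hmq : Measurable fun ω => quadVar σ s t ω := by
    have := (measurable_quadVar hd.ito.progressive s).comp
      (measurable_prodMk_left (x := (t : ℝ)))
    simpa only [Function.comp_def, Real.toNNReal_coe] using this
  refine ne_top_of_le_ne_top hDtop ?_
  calc _ = ∫⁻ ω in A, liminf (fun R : ℕ =>
          ENNReal.ofReal (min (quadVar σ s t ω).toReal R ^ 2)) atTop ∂P := by
        refine lintegral_congr fun ω => (Tendsto.liminf_eq ?_).symm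
        refine tendsto_const_nhds.congr' ?_
        filter_upwards [eventually_ge_atTop ⌈(quadVar σ s t ω).toReal⌉₊] with R hR
        rw [min_eq_left ((Nat.le_ceil _).trans (Nat.cast_le.2 hR))]
    _ ≤ liminf (fun R : ℕ =>
          ∫⁻ ω in A, ENNReal.ofReal (min (quadVar σ s t ω).toReal R ^ 2) ∂P) atTop :=
        lintegral_liminf_le fun R => ((hmq.ennreal_toReal.min measurable_const).pow_const
          2).ennreal_ofReal
    _ ≤ liminf (fun _ : ℕ => D) atTop := liminf_le_liminf (Eventually.of_forall hmin)
    _ = D := liminf_const D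

end IsVarianceDay

/-- The integral over a unit interval of the solution of a linear Volterra equation, that is, of
the derivative of the solution `f` of `f' = V + (t - s) c + β f`, `f s = 0`. -/
lemma integral_eq_of_volterra {y : ℝ → ℝ} {s V c β : ℝ} (hβ : β ≠ 0)
    (hy : IntervalIntegrable y volume s (s + 1))
    (h : ∀ t ∈ Set.Icc s (s + 1), y t = V + (t - s) * c + β * ∫ u in s..t, y u) :
    ∫ u in s..(s + 1), y u =
      β⁻¹ * (Real.exp β - 1) * V + (β ^ 2)⁻¹ * (Real.exp β - 1 - β) * c := by
  let f : ℝ → ℝ := fun t => β⁻¹ * (Real.exp (β * (t - s)) - 1) * V +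
    (β ^ 2)⁻¹ * (Real.exp (β * (t - s)) - 1 - β * (t - s)) * c
  let f' : ℝ → ℝ := fun t => V + (t - s) * c + β * f t
  have hf : ∀ t, HasDerivAt f (f' t) t := by
    intro t
    have h1 : HasDerivAt (fun t => β * (t - s)) (β * 1) t :=
      ((hasDerivAt_id t).sub_const s).const_mul β
    have h2 := ((h1.exp.sub_const 1).const_mul β⁻¹).mul_const V
    have h3 := (((h1.exp.sub_const 1).sub h1).const_mul (β ^ 2)⁻¹).mul_const c
    convert! h2.add h3 using 1
    simp only [f', f]
    field_simp
    ring
  have hfc : Continuous f := by fun_prop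
  have hfc' : Continuous f' := by fun_prop
  have hfint : ∀ t, ∫ u in s..t, f' u = f t := by
    intro t
    rw [intervalIntegral.integral_eq_sub_of_hasDerivAt (fun u _ => hf u)
      (hfc'.intervalIntegrable _ _)]
    simp [f]
  let d : ℝ → ℝ := fun t => (∫ u in s..t, y u) - f t
  have hs1 : s ≤ s + 1 := by linarith
  have hdc : ContinuousOn d (Set.Icc s (s + 1)) := by
    have hy' : IntegrableOn y (Set.uIcc s (s + 1)) volume := by
      rw [Set.uIcc_of_le hs1, integrableOn_Icc_iff_integrableOn_Ioc]
      exact (intervalIntegrable_iff_integrableOn_Ioc_of_le hs1).1 hy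
    have := intervalIntegral.continuousOn_primitive_interval hy'
    rw [Set.uIcc_of_le hs1] at this
    exact this.sub hfc.continuousOn
  have hd : ∀ t ∈ Set.Icc s (s + 1), d t = ∫ u in s..t, β * d u := by
    intro t ht
    have hyt : IntervalIntegrable y volume s t := hy.mono_set (by
      rw [Set.uIcc_of_le ht.1, Set.uIcc_of_le hs1]; exact Set.Icc_subset_Icc_right ht.2)
    calc d t = (∫ u in s..t, y u) - ∫ u in s..t, f' u := by rw [hfint]
      _ = ∫ u in s..t, (y u - f' u) :=
          (intervalIntegral.integral_sub hyt (hfc'.intervalIntegrable _ _)).symm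
      _ = _ := by
          refine intervalIntegral.integral_congr fun u hu => ?_
          rw [Set.uIcc_of_le ht.1] at hu
          simp only [h u ⟨hu.1, hu.2.trans ht.2⟩, f', d]
          ring
  obtain ⟨C, hC⟩ := isCompact_Icc.exists_bound_of_continuousOn hdc
  have hG := le_of_le_add_lintegral (G := fun t => ENNReal.ofReal |d t|) (s := s) (a := 0)
    (C := ENNReal.ofReal C) (abs_pos.2 hβ) ENNReal.ofReal_ne_top
    (fun t ht => ENNReal.ofReal_le_ofReal (hC t ht)) (fun t ht => by
      have hint : IntegrableOn (fun u => |d u|) (Set.Ioc s t) := by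
        have := (hdc.mono (Set.Icc_subset_Icc_right ht.2)).abs.integrableOn_Icc (μ := volume)
        exact this.mono_set Set.Ioc_subset_Icc_self
      rw [zero_add, ← ofReal_integral_eq_lintegral_ofReal hint (ae_of_all _ fun u => abs_nonneg _),
        ← ENNReal.ofReal_mul (abs_nonneg _), ← integral_const_mul]
      refine ENNReal.ofReal_le_ofReal ?_
      rw [hd t ht, intervalIntegral.integral_of_le ht.1]
      refine abs_integral_le_integral_abs.trans (le_of_eq ?_)
      simp only [abs_mul])
  have h0 := hG (s + 1) ⟨hs1, le_rfl⟩
  simp only [mul_zero, zero_mul, nonpos_iff_eq_zero, ENNReal.ofReal_eq_zero] at h0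
  have h1 : d (s + 1) = 0 := abs_nonpos_iff.1 h0
  have h2 : ∫ u in s..(s + 1), y u = f (s + 1) := sub_eq_zero.1 h1
  rw [h2]
  simp [f]

namespace IsVarianceDay

variable {Ω : Type*} {mΩ : MeasurableSpace Ω} {P : Measure Ω} [IsProbabilityMeasure P]
  {F : Filtration ℝ≥0 mΩ} {β : ℝ} {B σ I : ℝ≥0 → Ω → ℝ} {s : ℝ≥0} {v a : Ω → ℝ}

/-- Fubini's theorem for the quadratic variation. -/
lemma setIntegral_quadVar (hI : IsItoIntegral P F B σ I) {A : Set Ω} {t : ℝ≥0} (hst : s ≤ t)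
    (hQ : IntegrableOn (fun ω => (quadVar σ s t ω).toReal) A P) :
    IntervalIntegrable (fun u => ∫ ω in A, σ u.toNNReal ω ^ 2 ∂P) volume s t ∧
      ∫ ω in A, (quadVar σ s t ω).toReal ∂P =
        ∫ u in (s : ℝ)..t, ∫ ω in A, σ u.toNNReal ω ^ 2 ∂P := by
  have hst' : (s : ℝ) ≤ t := NNReal.coe_le_coe.2 hst
  have hm : Measurable fun p : Ω × ℝ => σ p.2.toNNReal p.1 ^ 2 :=
    ((measurable_uncurry_progressive hI.progressive).comp measurable_swap).pow_const 2
  have hint : Integrable (fun p : Ω × ℝ => σ p.2.toNNReal p.1 ^ 2)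
      ((P.restrict A).prod (volume.restrict (Set.Ioc (s : ℝ) t))) := by
    refine ⟨hm.aestronglyMeasurable, ?_⟩
    rw [hasFiniteIntegral_iff_ofReal (ae_of_all _ fun p => sq_nonneg _),
      lintegral_prod _ hm.ennreal_ofReal.aemeasurable]
    have e : ∫⁻ ω in A, quadVar σ s t ω ∂P =
        ∫⁻ ω in A, ENNReal.ofReal (quadVar σ s t ω).toReal ∂P := by
      refine lintegral_congr_ae ?_
      filter_upwards [ae_restrict_of_ae hI.ae_quadVar_ne_top] with ω h
      rw [ENNReal.ofReal_toReal (h s t)]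
    have h2 := (hasFiniteIntegral_iff_ofReal (ae_of_all _ fun ω => ENNReal.toReal_nonneg)).1 hQ.2
    rw [← e] at h2
    exact h2
  refine ⟨?_, ?_⟩
  · rw [intervalIntegrable_iff_integrableOn_Ioc_of_le hst']
    exact hint.integral_prod_right
  · rw [intervalIntegral.integral_of_le hst',
      ← integral_integral_swap (f := fun ω u => σ (Real.toNNReal u) ω ^ 2) hint]
    refine integral_congr_ae (ae_of_all _ fun ω => ?_)
    have hmω : Measurable fun u : ℝ => σ u.toNNReal ω ^ 2 := hm.comp measurable_prodMk_left
    simp only [integral_eq_lintegral_of_nonneg_ae (ae_of_all _ fun u : ℝ => sq_nonneg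
      (σ u.toNNReal ω)) hmω.aestronglyMeasurable]
    rfl

/-- The conditional mean and variance of the increment over the day, tested on an event of the past
on which the day starts with bounded data. -/
lemma setIntegral_increment (hd : IsVarianceDay P F β B σ I s v a) (hβ : β ≠ 0) {A : Set Ω}
    (hA : MeasurableSet[F s] A) {K : ℝ} (hv : ∀ ω ∈ A, |v ω| ≤ K) (ha : ∀ ω ∈ A, |a ω| ≤ K) :
    IntegrableOn (fun ω => (I (s + 1) ω - I s ω) ^ 2) A P ∧
      ∫ ω in A, (I (s + 1) ω - I s ω) ∂P = 0 ∧
      ∫ ω in A, (I (s + 1) ω - I s ω) ^ 2 ∂P =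
        ∫ ω in A, (β⁻¹ * (Real.exp β - 1) * v ω +
          (β ^ 2)⁻¹ * (Real.exp β - 1 - β) * a ω) ∂P := by
  have hA' := F.le _ _ hA
  have iso : ∀ t : ℝ≥0, s ≤ t → t ≤ s + 1 →
      IntegrableOn (fun ω => (I t ω - I s ω) ^ 2) A P ∧
      IntegrableOn (fun ω => (quadVar σ s t ω).toReal) A P ∧
      ∫ ω in A, (I t ω - I s ω) ∂P = 0 ∧
      ∫ ω in A, (I t ω - I s ω) ^ 2 ∂P = ∫ ω in A, (quadVar σ s t ω).toReal ∂P := by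
    intro t hst ht
    obtain ⟨T⟩ := hd.ito.nonempty_stoppedApprox hd.brownian hst
    exact T.isometry hA (hd.lintegral_quadVar_sq_ne_top hA hv ha hst ht)
  have iv : IntegrableOn v A P :=
    IntegrableOn.of_bound (measure_lt_top P A)
      (hd.measurable_v.mono (F.le s)).aestronglyMeasurable.restrict K
      ((ae_restrict_mem hA').mono fun ω h => hv ω h)
  have ia : IntegrableOn a A P :=
    IntegrableOn.of_bound (measure_lt_top P A)
      (hd.measurable_a.mono (F.le s)).aestronglyMeasurable.restrict K
      ((ae_restrict_mem hA').mono fun ω h => ha ω h)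
  have hs1 : s ≤ s + 1 := le_self_add
  obtain ⟨h1, h2, h3, h4⟩ := iso (s + 1) hs1 le_rfl
  refine ⟨h1, h3, ?_⟩
  obtain ⟨h5, h6⟩ := setIntegral_quadVar hd.ito hs1 h2
  rw [NNReal.coe_add, NNReal.coe_one] at h5 h6
  rw [h4, h6, integral_add (iv.const_mul _) (ia.const_mul _), integral_const_mul,
    integral_const_mul]
  refine integral_eq_of_volterra hβ h5 fun t ht => ?_
  obtain ⟨t, rfl⟩ : ∃ t' : ℝ≥0, (t' : ℝ) = t :=
    ⟨t.toNNReal, Real.coe_toNNReal t (s.coe_nonneg.trans ht.1)⟩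
  have hst : s ≤ t := NNReal.coe_le_coe.1 ht.1
  have ht1 : t ≤ s + 1 := by
    rw [← NNReal.coe_le_coe]; simpa using ht.2
  obtain ⟨j1, j2, -, j4⟩ := iso t hst ht1
  rw [← (setIntegral_quadVar hd.ito hst j2).2, ← j4, Real.toNNReal_coe]
  have e : ∫ ω in A, σ t ω ^ 2 ∂P =
      ∫ ω in A, (v ω + ((t : ℝ) - s) * a ω + β * (I t ω - I s ω) ^ 2) ∂P := by
    refine integral_congr_ae ?_
    filter_upwards [ae_restrict_of_ae hd.sq_eq] with ω h using h t ⟨hst, ht1⟩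
  have i2 : IntegrableOn (fun ω => v ω + ((t : ℝ) - s) * a ω) A P := iv.add (ia.const_mul _)
  rw [e, integral_add i2 (j1.const_mul β), integral_add iv (ia.const_mul _), integral_const_mul,
    integral_const_mul]

end IsVarianceDay

/-! ### Conditional variance of the increment over a day -/

namespace IsVarianceDay

variable {Ω : Type*} {mΩ : MeasurableSpace Ω} {P : Measure Ω}
  {F : Filtration ℝ≥0 mΩ} {β : ℝ} {B σ I : ℝ≥0 → Ω → ℝ} {s : ℝ≥0} {v a : Ω → ℝ}

/-- The event that the day starts with data bounded by `K`. -/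
def boundedStart (v a : Ω → ℝ) (K : ℕ) : Set Ω := {ω | |v ω| ≤ K} ∩ {ω | |a ω| ≤ K}

lemma measurableSet_boundedStart (hd : IsVarianceDay P F β B σ I s v a) (K : ℕ) :
    MeasurableSet[F s] (boundedStart v a K) :=
  (hd.measurable_v.norm.measurable measurableSet_Iic).inter
    (hd.measurable_a.norm.measurable measurableSet_Iic)

lemma eventually_mem_boundedStart (v a : Ω → ℝ) (ω : Ω) :
    ∀ᶠ K in atTop, ω ∈ boundedStart v a K := by
  filter_upwards [eventually_ge_atTop ⌈|v ω|⌉₊, eventually_ge_atTop ⌈|a ω|⌉₊] with K h1 h2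
  exact ⟨(Nat.le_ceil _).trans (Nat.cast_le.2 h1), (Nat.le_ceil _).trans (Nat.cast_le.2 h2)⟩

lemma aecover_boundedStart (hd : IsVarianceDay P F β B σ I s v a) :
    AECover P atTop (boundedStart v a) where
  ae_eventually_mem := ae_of_all _ (eventually_mem_boundedStart v a)
  measurableSet K := F.le s _ (hd.measurableSet_boundedStart K)

/-- The conditional variance of the increment over a day with starting data `v` and `a`. -/
noncomputable def dayVariance (β : ℝ) (v a : Ω → ℝ) (ω : Ω) : ℝ :=
  β⁻¹ * (Real.exp β - 1) * v ω + (β ^ 2)⁻¹ * (Real.exp β - 1 - β) * a ω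

lemma stronglyMeasurable_dayVariance (hd : IsVarianceDay P F β B σ I s v a) :
    StronglyMeasurable[F s] (dayVariance β v a) :=
  (hd.measurable_v.const_mul _).add (hd.measurable_a.const_mul _)

variable [IsProbabilityMeasure P]

lemma setIntegral_inter_boundedStart (hd : IsVarianceDay P F β B σ I s v a) (hβ : β ≠ 0)
    {A : Set Ω} (hA : MeasurableSet[F s] A) (K : ℕ) :
    IntegrableOn (fun ω => (I (s + 1) ω - I s ω) ^ 2) (A ∩ boundedStart v a K) P ∧
      ∫ ω in A ∩ boundedStart v a K, (I (s + 1) ω - I s ω) ∂P = 0 ∧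
      ∫ ω in A ∩ boundedStart v a K, (I (s + 1) ω - I s ω) ^ 2 ∂P =
        ∫ ω in A ∩ boundedStart v a K, dayVariance β v a ω ∂P :=
  hd.setIntegral_increment hβ (MeasurableSet.inter hA (hd.measurableSet_boundedStart K))
    (fun _ h => h.2.1) fun _ h => h.2.2

lemma aestronglyMeasurable_increment (hd : IsVarianceDay P F β B σ I s v a) :
    AEStronglyMeasurable (fun ω => I (s + 1) ω - I s ω) P :=
  (hd.ito.nonempty_stoppedApprox hd.brownian le_self_add).some.aestronglyMeasurable_left

lemma memLp_increment (hd : IsVarianceDay P F β B σ I s v a) (hβ : β ≠ 0)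
    (iv : Integrable v P) (ia : Integrable a P) :
    MemLp (fun ω => I (s + 1) ω - I s ω) 2 P := by
  have iD : Integrable (dayVariance β v a) P := (iv.const_mul _).add (ia.const_mul _)
  rw [memLp_two_iff_integrable_sq hd.aestronglyMeasurable_increment]
  have h := fun K => hd.setIntegral_inter_boundedStart hβ MeasurableSet.univ K
  simp only [Set.univ_inter] at h
  refine hd.aecover_boundedStart.integrable_of_integral_bounded_of_nonneg_ae
    (∫ ω, |dayVariance β v a ω| ∂P) (fun K => (h K).1) (ae_of_all _ fun ω => sq_nonneg _)
    (Eventually.of_forall fun K => ?_)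
  rw [(h K).2.2]
  exact (integral_mono iD.integrableOn iD.abs.integrableOn fun ω => le_abs_self _).trans
    (setIntegral_le_integral iD.abs (ae_of_all _ fun ω => abs_nonneg _))

lemma condExp_increment (hd : IsVarianceDay P F β B σ I s v a) (hβ : β ≠ 0)
    (hM : MemLp (fun ω => I (s + 1) ω - I s ω) 2 P) :
    P[fun ω => I (s + 1) ω - I s ω | F s] =ᵐ[P] 0 := by
  have hM1 : Integrable (fun ω => I (s + 1) ω - I s ω) P := hM.integrable one_le_two
  refine (ae_eq_condExp_of_forall_setIntegral_eq (F.le s) hM1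
    (fun _ _ _ => integrable_zero _ _ _) (fun A hA _ => ?_)
    aestronglyMeasurable_zero).symm
  have h1 := hd.aecover_boundedStart.restrict.integral_tendsto_of_countably_generated
    (hM1.integrableOn (s := A))
  have h2 : ∀ K, ∫ ω in boundedStart v a K, (I (s + 1) ω - I s ω) ∂(P.restrict A) = 0 := by
    intro K
    rw [Measure.restrict_restrict (F.le s _ (hd.measurableSet_boundedStart K)), Set.inter_comm]
    exact (hd.setIntegral_inter_boundedStart hβ hA K).2.1
  simp only [h2] at h1
  simpa using tendsto_nhds_unique tendsto_const_nhds h1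

lemma condVar_increment (hd : IsVarianceDay P F β B σ I s v a) (hβ : β ≠ 0)
    (hM : MemLp (fun ω => I (s + 1) ω - I s ω) 2 P) :
    Var[fun ω => I (s + 1) ω - I s ω; P | F s] =ᵐ[P] dayVariance β v a := by
  set M : Ω → ℝ := fun ω => I (s + 1) ω - I s ω
  have hM2 : Integrable (fun ω => M ω ^ 2) P := hM.integrable_sq
  have h1 : Var[M; P | F s] =ᵐ[P] P[fun ω => M ω ^ 2 | F s] := by
    refine condExp_congr_ae ?_
    filter_upwards [hd.condExp_increment hβ hM] with ω h
    have h' : P[M | F s] ω = 0 := h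
    simp [h']
  -- The two sides agree on the events on which the day starts with bounded data.
  have h2 : ∀ K, (boundedStart v a K).indicator (dayVariance β v a) =ᵐ[P]
      (boundedStart v a K).indicator (P[fun ω => M ω ^ 2 | F s]) := by
    intro K
    have hK := hd.measurableSet_boundedStart K
    have hK' := F.le s _ hK
    refine EventuallyEq.trans ?_ (condExp_indicator hM2 hK)
    have iD : Integrable ((boundedStart v a K).indicator (dayVariance β v a)) P := by
      rw [integrable_indicator_iff hK']
      refine Integrable.add ?_ ?_
      · refine Integrable.const_mul (IntegrableOn.of_bound (measure_lt_top P _)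
          (hd.measurable_v.mono (F.le s)).aestronglyMeasurable.restrict K ?_) _
        exact (ae_restrict_mem hK').mono fun ω h => h.1
      · refine Integrable.const_mul (IntegrableOn.of_bound (measure_lt_top P _)
          (hd.measurable_a.mono (F.le s)).aestronglyMeasurable.restrict K ?_) _
        exact (ae_restrict_mem hK').mono fun ω h => h.2
    refine ae_eq_condExp_of_forall_setIntegral_eq (F.le s) (hM2.indicator hK')
      (fun _ _ _ => iD.integrableOn) (fun A hA _ => ?_)
      (hd.stronglyMeasurable_dayVariance.indicator hK).aestronglyMeasurable
    rw [setIntegral_indicator hK', setIntegral_indicator hK']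
    exact (hd.setIntegral_inter_boundedStart hβ hA K).2.2.symm
  filter_upwards [h1, ae_all_iff.2 h2] with ω h3 h4
  obtain ⟨K, hK⟩ := (eventually_mem_boundedStart v a ω).exists
  have h5 := h4 K
  rw [Set.indicator_of_mem hK, Set.indicator_of_mem hK] at h5
  rw [h3, h5]

end IsVarianceDay

/-! ### The daily recursion -/

namespace IsGarchItoOI

variable {Ω : Type*} {mΩ : MeasurableSpace Ω} {P : Measure Ω}
  {F : Filtration ℝ≥0 mΩ} {θ : Params} {B σ : ℝ≥0 → Ω → ℝ} {O : ℕ → Ω → ℝ} {X : ℝ≥0 → Ω → ℝ}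

/-- The slope `ω + (γ - 1) σ_n² + α O_n` of the deterministic part of the variance on the day
`[n, n + 1]`. -/
def slope (θ : Params) (σ : ℝ≥0 → Ω → ℝ) (O : ℕ → Ω → ℝ) (n : ℕ) (ω : Ω) : ℝ :=
  θ.ω + (θ.γ - 1) * σ n ω ^ 2 + θ.α * O n ω

/-- Each day of the model follows the variance dynamics, including its right end point, which is
reached by continuity. -/
lemma exists_isVarianceDay (hX : IsGarchItoOI P F θ 0 B σ O X) :
    ∃ I : ℝ≥0 → Ω → ℝ,
      (∀ n : ℕ, IsVarianceDay P F θ.β B σ I n (fun ω => σ n ω ^ 2) (slope θ σ O n)) ∧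
      ∀ n : ℕ, dailyReturn X (n + 1) =ᵐ[P] fun ω => I ((n : ℝ≥0) + 1) ω - I n ω := by
  obtain ⟨I, hI, hXI, hσ⟩ := hX.dynamics
  refine ⟨I, fun n => ?_, fun n => ?_⟩
  · have mσ : StronglyMeasurable[F n] fun ω => σ n ω ^ 2 :=
      (hI.progressive.stronglyAdapted n).pow 2
    refine ⟨hX.brownian, hI, hX.continuous_variance, mσ,
      (stronglyMeasurable_const.add (mσ.const_mul _)).add
        ((hX.option_measurable n).const_mul _), ?_⟩
    filter_upwards [hσ, hX.continuous_variance, hI.continuous_paths] with ω h1 h2 h3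
    have h4 : Set.EqOn (fun t => σ t ω ^ 2) (fun t : ℝ≥0 => σ n ω ^ 2 +
        ((t : ℝ) - (n : ℝ≥0)) * slope θ σ O n ω + θ.β * (I t ω - I n ω) ^ 2)
        (Set.Ico (n : ℝ≥0) (n + 1)) := by
      intro t ht
      have hfl : ⌊t⌋₊ = n := (Nat.floor_eq_iff zero_le).2 ht
      have := h1 t
      rw [hfl] at this
      simpa [slope] using this
    have h5 := h4.closure h2 (by fun_prop)
    rw [closure_Ico (by simp)] at h5
    exact h5
  · filter_upwards [hXI] with ω h
    simp only [dailyReturn, Nat.add_sub_cancel, Nat.cast_add, Nat.cast_one]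
    rw [h (n + 1), h n]
    ring

lemma integrable_slope {n : ℕ} (iσ : Integrable (fun ω => σ n ω ^ 2) P)
    (iO : Integrable (O n) P) [IsFiniteMeasure P] : Integrable (slope θ σ O n) P :=
  ((integrable_const _).add (iσ.const_mul _)).add (iO.const_mul _)

end IsGarchItoOI

end GarchIto

/-- The daily conditional variances of the driftless GARCH-Itô-OI model obey the GARCH-type
recursion whenever the returns involved are square integrable, and all daily returns are square
integrable as soon as the initial variance and the option-implied variances are integrable. -/
theorem proposition1 {Ω : Type*} [mΩ : MeasurableSpace Ω] (P : Measure Ω) [IsProbabilityMeasure P]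
    (F : Filtration ℝ≥0 mΩ) (θ : GarchIto.Params) (hβ : θ.β ≠ 0)
    (B σ : ℝ≥0 → Ω → ℝ) (O : ℕ → Ω → ℝ) (X : ℝ≥0 → Ω → ℝ)
    (hX : GarchIto.IsGarchItoOI P F θ 0 B σ O X) :
    (∀ n : ℕ, 2 ≤ n →
      MemLp (GarchIto.dailyReturn X (n - 1)) 2 P → MemLp (GarchIto.dailyReturn X n) 2 P →
      ∀ᵐ ω ∂P, GarchIto.dailyCondVar P F X n ω =
        θ.ωg + θ.γ * GarchIto.dailyCondVar P F X (n - 1) ω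
          + θ.βg * GarchIto.dailyReturn X (n - 1) ω ^ 2
          + θ.ηg * O (n - 1) ω + θ.ξg * O (n - 2) ω) ∧
    (Integrable (fun ω => σ 0 ω ^ 2) P → (∀ n : ℕ, Integrable (O n) P) →
      ∀ n : ℕ, 1 ≤ n → MemLp (GarchIto.dailyReturn X n) 2 P) := by
  obtain ⟨I, hday, hZ⟩ := hX.exists_isVarianceDay
  have hvar : ∀ n : ℕ, MemLp (GarchIto.dailyReturn X (n + 1)) 2 P →
      GarchIto.dailyCondVar P F X (n + 1) =ᵐ[P]
        GarchIto.IsVarianceDay.dayVariance θ.β (fun ω => σ n ω ^ 2)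
          (GarchIto.IsGarchItoOI.slope θ σ O n) := fun n h =>
    (condVar_congr_ae (hZ n)).trans
      ((hday n).condVar_increment hβ ((memLp_congr_ae (hZ n)).1 h))
  have hstep : ∀ n : ℕ, ∀ᵐ ω ∂P, σ ((n + 1 : ℕ) : ℝ≥0) ω ^ 2 =
      σ n ω ^ 2 + GarchIto.IsGarchItoOI.slope θ σ O n ω
        + θ.β * GarchIto.dailyReturn X (n + 1) ω ^ 2 := by
    intro n
    filter_upwards [(hday n).sq_eq, hZ n] with ω h1 h2
    rw [h2, Nat.cast_add, Nat.cast_one, h1 (n + 1) ⟨le_self_add, le_rfl⟩]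
    push_cast
    ring
  refine ⟨fun n hn hZ1 hZ2 => ?_, fun hσ hO => ?_⟩
  · obtain ⟨m, rfl⟩ := Nat.exists_eq_add_of_le' hn
    change MemLp (GarchIto.dailyReturn X (m + 1)) 2 P at hZ1
    filter_upwards [hvar m hZ1, hvar (m + 1) hZ2, hstep m] with ω h1 h2 h3
    change GarchIto.dailyCondVar P F X (m + 1 + 1) ω =
        θ.ωg + θ.γ * GarchIto.dailyCondVar P F X (m + 1) ω
          + θ.βg * GarchIto.dailyReturn X (m + 1) ω ^ 2
          + θ.ηg * O (m + 1) ω + θ.ξg * O m ω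
    rw [h1, h2]
    simp only [GarchIto.IsVarianceDay.dayVariance, GarchIto.IsGarchItoOI.slope] at h3 ⊢
    rw [h3]
    simp only [GarchIto.Params.ωg, GarchIto.Params.βg, GarchIto.Params.ηg, GarchIto.Params.ξg]
    field_simp
    ring
  · have key : ∀ n : ℕ, Integrable (fun ω => σ n ω ^ 2) P →
        MemLp (GarchIto.dailyReturn X (n + 1)) 2 P := fun n h => (memLp_congr_ae (hZ n)).2
      ((hday n).memLp_increment hβ h (GarchIto.IsGarchItoOI.integrable_slope h (hO n)))
    have hint : ∀ n : ℕ, Integrable (fun ω => σ n ω ^ 2) P := by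
      intro n
      induction n with
      | zero => simpa using hσ
      | succ n ih =>
        have h1 : Integrable (fun ω => σ n ω ^ 2 + GarchIto.IsGarchItoOI.slope θ σ O n ω
            + θ.β * GarchIto.dailyReturn X (n + 1) ω ^ 2) P :=
          (ih.add (GarchIto.IsGarchItoOI.integrable_slope ih (hO n))).add
            ((key n ih).integrable_sq.const_mul _)
        exact h1.congr ((hstep n).mono fun ω h => h.symm)
    intro n hn
    obtain ⟨m, rfl⟩ := Nat.exists_eq_add_of_le' hn
    exact key m (hint m)
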